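/- Let $k\ge 1$, let $n_1,\dots,n_k\ge 2$ be integers, and let $H$ be a complex Hilbert space. Let $\mathbf T=(T_1,\dots,T_k)$ with $T_i=(T_{i,1},\dots,T_{i,n_i})\in B(H)^{n_i}$, where the entries of $T_s$ commute with the entries of $T_t$ for $s\ne t$. Put $\Phi_{T_i}(Y)=\sum_{j=1}^{n_i}T_{i,j}YT_{i,j}^*$ for $Y\in B(H)$. Assume that $\mathbf T$ belongs to the regular polyball $\mathbf B_{\mathbf n}(H)$, i.e. $(\mathrm{id}-\Phi_{T_1})^{p_1}\circ\cdots\circ(\mathrm{id}-\Phi_{T_k})^{p_k}(I)\ge 0$ for all $p\in\{0,1\}^k$, and let $\Delta:=(\mathrm{id}-\Phi_{T_1})\circ\cdots\circ(\mathrm{id}-\Phi_{T_k})(I)$ be its defect operator. Assume moreover that * $\mathbf T$ is pure: for every $i$, $\Phi_{T_i}^p(I)\to 0$ strongly as $p\to\infty$; * $\mathbf T$ has rank one: $\operatorname{rank}\Delta=1$; * $\mathbf T$ is graded: there is a strongly continuous unitary representation $U$ of the torus $\mathbb T^k$ on $H$ such that $U(\lambda)T_{i,j}U(\lambda)^*=\lambda_iT_{i,j}$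 for all $\lambda\in\mathbb T^k$ and all $i,j$. For a word $\alpha=g_{j_1}\cdots g_{j_p}$ in the free monoid $\mathbb F_{n_i}^+$ put $|\alpha|=p$ and $T_{i,\alpha}=T_{i,j_1}\cdots T_{i,j_p}$. Let $F^2(H_{n_i})$ be the full Fock space over $\mathbb C^{n_i}$ with its orthonormal basis $\{e^i_\alpha\}_{\alpha\in\mathbb F_{n_i}^+}$, let $P^{(i)}_q$ be the orthogonal projection of $F^2(H_{n_i})$ onto $\operatorname{span}\{e^i_\alpha:|\alpha|=q\}$, and let $\mathbf K_{\mathbf T}:H\to F^2(H_{n_1})\otimes\cdots\otimes F^2(H_{n_k})\otimes\overline{\Delta H}$ be the Berezin kernel $$\mathbf K_{\mathbf T}h=\sum_{\beta_i\in\mathbb F_{n_i}^+}e^1_{\beta_1}\otimes\cdots\otimes e^k_{\beta_k}\otimes\Delta^{1/2}T_{1,\beta_1}^*\cdots T_{k,\beta_k}^*h .$$ Let the curvature and the Euler characteristic of $\mathbf T$ be $$\operatorname{curv}(\mathbf T)=\lim_{m\to\infty}\frac1{\binom{m+k}{k}}\sum_{\substack{q_1,\dots,q_k\ge0\\ q_1+\cdots+q_k\le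 m}}\frac{\operatorname{trace}\big[\mathbf K_{\mathbf T}^*(P^{(1)}_{q_1}\otimes\cdots\otimes P^{(k)}_{q_k}\otimes I)\mathbf K_{\mathbf T}\big]}{\operatorname{trace}\big[P^{(1)}_{q_1}\otimes\cdots\otimes P^{(k)}_{q_k}\big]},$$ $$\chi(\mathbf T)=\lim_{m\to\infty}\frac{\dim\operatorname{span}\{T_{1,\alpha_1}\cdots T_{k,\alpha_k}h:\ |\alpha_i|\le q^{(m)}_i\ (1\le i\le k),\ h\in\Delta H\}}{\prod_{i=1}^k\big(1+n_i+\cdots+n_i^{q^{(m)}_i}\big)},$$ where $(\mathbf q^{(m)})_m$ is any increasing cofinal sequence in $\mathbb Z_+^k$. Then both limits exist, the second one is independent of the choice of $(\mathbf q^{(m)})_m$, and $$\operatorname{curv}(\mathbf T)=\chi(\mathbf T).$$ -/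

import Mathlib

open scoped ENNReal
open Filter Topology

noncomputable section

namespace NCPolyball

variable {H : Type*} [NormedAddCommGroup H] [InnerProductSpace ℂ H] [CompleteSpace H]
variable {k : ℕ} {n : Fin k → ℕ}

/-! ### Tuples of operators and the regular polyball -/

/-- A tuple `T = (T_1, …, T_k)` in `B(H)^{n_1} × ⋯ × B(H)^{n_k}`, `T_i = (T_{i,1}, …, T_{i,n_i})`. -/
abbrev OpTuple (n : Fin k → ℕ) (H : Type*) [NormedAddCommGroup H] [InnerProductSpace ℂ H] : Type _ :=
  ∀ i : Fin k, Fin (n i) → (H →L[ℂ] H)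

/-- The completely positive map `Φ_X(Y) = ∑_j X_j Y X_j^*` of a row `X = (X_1, …, X_m)`. -/
def Phi {m : ℕ} (X : Fin m → (H →L[ℂ] H)) : Module.End ℂ (H →L[ℂ] H) where
  toFun Y := ∑ j, X j * Y * star (X j)
  map_add' Y Z := by simp [mul_add, add_mul, Finset.sum_add_distrib]
  map_smul' c Y := by simp [Finset.smul_sum]

/-- The defect mapping `Δ_T^p = (id - Φ_{T_1})^{p_1} ∘ ⋯ ∘ (id - Φ_{T_k})^{p_k}`. -/
def defectMap (T : OpTuple n H) (p : Fin k → ℕ) : Module.End ℂ (H →L[ℂ] H) :=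
  (List.ofFn fun i => (1 - Phi (T i)) ^ p i).prod

/-- The defect operator `Δ_T(I) = (id - Φ_{T_1}) ∘ ⋯ ∘ (id - Φ_{T_k}) (I)`. -/
def defect (T : OpTuple n H) : H →L[ℂ] H := defectMap T (fun _ => 1) 1

/-- The range `Δ_T(I)(H)` of the defect operator. -/
def defectRange (T : OpTuple n H) : Submodule ℂ H := LinearMap.range (defect T : H →ₗ[ℂ] H)

/-- Membership in the regular polyball `B_n(H)`: the entries of `T_s` commute with those of `T_t`
for `s ≠ t`, and `Δ_T^p(I) ≥ 0` for all `0 ≤ p ≤ (1, …, 1)`. -/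
structure InPolyball (T : OpTuple n H) : Prop where
  commute : ∀ s t, s ≠ t → ∀ i j, Commute (T s i) (T t j)
  nonneg : ∀ p : Fin k → ℕ, (∀ i, p i ≤ 1) → 0 ≤ defectMap T p 1

/-- `T` is pure: `Φ_{T_i}^p(I) → 0` strongly as `p → ∞`, for every `i`. -/
def IsPure (T : OpTuple n H) : Prop :=
  ∀ i, ∀ x : H, Tendsto (fun p : ℕ => ((Phi (T i) ^ p) 1) x) atTop (𝓝 0)

/-- `T` has rank one: its defect operator has rank one. -/
def HasRankOne (T : OpTuple n H) : Prop := Module.finrank ℂ (defectRange T) = 1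

/-- `T` is `ℤ^k`-graded: there is a gauge group, i.e. a strongly continuous unitary representation
`U` of the `k`-torus on `H`, such that `U(λ) T_{i,j} U(λ)^* = λ_i T_{i,j}`. -/
def IsGraded (T : OpTuple n H) : Prop :=
  ∃ U : (Fin k → Circle) →* unitary (H →L[ℂ] H),
    (∀ x : H, Continuous fun z : Fin k → Circle => (U z : H →L[ℂ] H) x) ∧
    ∀ (z : Fin k → Circle) (i : Fin k) (j : Fin (n i)),
      (U z : H →L[ℂ] H) * T i j * star (U z : H →L[ℂ] H) = (z i : ℂ) • T i j

/-! ### Words and tensor products of full Fock spaces -/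

/-- The index set `F_{n_1}^+ × ⋯ × F_{n_k}^+`. -/
abbrev MultiWord (n : Fin k → ℕ) : Type := ∀ i, FreeMonoid (Fin (n i))

/-- `T_α = T_{j_1} ⋯ T_{j_p}` for a word `α = g_{j_1} ⋯ g_{j_p}` (the identity for the empty word). -/
def wordOp {m : ℕ} (X : Fin m → (H →L[ℂ] H)) : FreeMonoid (Fin m) →* (H →L[ℂ] H) :=
  FreeMonoid.lift X

/-- `T_{1,α_1} ⋯ T_{k,α_k}`. -/
def multiWordOp (T : OpTuple n H) (α : MultiWord n) : H →L[ℂ] H :=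
  (List.ofFn fun i => wordOp (T i) (α i)).prod

/-- `T_{1,β_1}^* ⋯ T_{k,β_k}^*`. -/
def multiWordOpStar (T : OpTuple n H) (β : MultiWord n) : H →L[ℂ] H :=
  (List.ofFn fun i => star (wordOp (T i) (β i))).prod

/-- The Hilbert space `F²(H_{n_1}) ⊗ ⋯ ⊗ F²(H_{n_k}) ⊗ E`, in the coordinates given by the
orthonormal basis `e_{β_1} ⊗ ⋯ ⊗ e_{β_k}` of `F²(H_{n_1}) ⊗ ⋯ ⊗ F²(H_{n_k})`: the vector
`e_{β_1} ⊗ ⋯ ⊗ e_{β_k} ⊗ x` is `lp.single 2 β x`. With `E = ℂ` it is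
`F²(H_{n_1}) ⊗ ⋯ ⊗ F²(H_{n_k})` itself. -/
abbrev Fock (n : Fin k → ℕ) (E : Type*) [NormedAddCommGroup E] : Type _ :=
  lp (fun _ : MultiWord n => E) 2

open Classical in
/-- The closed span of the vectors `e_{β_1} ⊗ ⋯ ⊗ e_{β_k} ⊗ x` with `|β_i| = q_i` for all `i`. -/
def degreeSubspace (n : Fin k → ℕ) (E : Type*) [NormedAddCommGroup E] [InnerProductSpace ℂ E]
    [CompleteSpace E] (q : Fin k → ℕ) : Submodule ℂ (Fock n E) :=
  (Submodule.span ℂ {f | ∃ (β : MultiWord n) (x : E),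
    (∀ i, (β i).length = q i) ∧ f = lp.single 2 β x}).topologicalClosure

instance completeSpace_degreeSubspace (E : Type*) [NormedAddCommGroup E] [InnerProductSpace ℂ E] [CompleteSpace E]
    (q : Fin k → ℕ) : CompleteSpace (degreeSubspace n E q) :=
  inferInstanceAs (CompleteSpace (Submodule.topologicalClosure _))

/-- The orthogonal projection `P_{q_1}^{(1)} ⊗ ⋯ ⊗ P_{q_k}^{(k)} ⊗ I_E`. -/
def degreeProj (n : Fin k → ℕ) (E : Type*) [NormedAddCommGroup E] [InnerProductSpace ℂ E]
    [CompleteSpace E] (q : Fin k → ℕ) : Fock n E →L[ℂ] Fock n E :=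
  (degreeSubspace n E q).starProjection

/-! ### Facts needed for the boundedness of the Berezin kernel -/

/-- Conjugation `Y ↦ a Y a^*` as a monoid homomorphism in `a`. -/
def conj : (H →L[ℂ] H) →* Module.End ℂ (H →L[ℂ] H) where
  toFun a :=
    { toFun := fun Y => a * Y * star a
      map_add' := fun Y Z => by simp [mul_add, add_mul]
      map_smul' := fun c Y => by simp }
  map_one' := by ext1 Y; simp
  map_mul' a b := by ext1 Y; simp [mul_assoc]

theorem conj_apply (a Y : H →L[ℂ] H) : conj a Y = a * Y * star a := rfl

theorem phi_eq {m : ℕ} (X : Fin m → (H →L[ℂ] H)) : Phi X = ∑ j, conj (X j) := by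
  ext1 Y
  simp [Phi, conj_apply, LinearMap.sum_apply]

theorem conj_nonneg (a : H →L[ℂ] H) {Y : H →L[ℂ] H} (hY : 0 ≤ Y) : 0 ≤ conj a Y :=
  star_right_conjugate_nonneg hY a

theorem phi_nonneg {m : ℕ} (X : Fin m → (H →L[ℂ] H)) {Y : H →L[ℂ] H} (hY : 0 ≤ Y) :
    0 ≤ Phi X Y :=
  Finset.sum_nonneg fun j _ => star_right_conjugate_nonneg hY (X j)

theorem phi_pow_nonneg {m : ℕ} (X : Fin m → (H →L[ℂ] H)) (N : ℕ) {Y : H →L[ℂ] H} (hY : 0 ≤ Y) :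
    0 ≤ (Phi X ^ N) Y := by
  induction N with
  | zero => simpa using hY
  | succ N ih =>
    rw [pow_succ', Module.End.mul_apply]
    exact phi_nonneg X ih

/-- The words of length `< N`. -/
def wordsLT (m : ℕ) : ℕ → Finset (FreeMonoid (Fin m))
  | 0 => ∅
  | N + 1 => by
      classical
      exact insert 1 ((Finset.univ ×ˢ wordsLT m N).image fun x => FreeMonoid.of x.1 * x.2)

theorem mem_wordsLT {m : ℕ} : ∀ (N : ℕ) (w : FreeMonoid (Fin m)), w.length < N → w ∈ wordsLT m N
  | 0, _, h => absurd h (Nat.not_lt_zero _)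
  | N + 1, w, h => by
      classical
      induction w using FreeMonoid.casesOn with
      | one => simp [wordsLT]
      | of_mul j w =>
        have hw : w.length < N := by
          have := h
          simp only [FreeMonoid.length_mul, FreeMonoid.length_of] at this
          omega
        simp only [wordsLT, Finset.mem_insert, Finset.mem_image]
        exact Or.inr ⟨(j, w), by simp [mem_wordsLT N w hw], rfl⟩

theorem sum_wordsLT_mul {m : ℕ} (X : Fin m → (H →L[ℂ] H)) (N : ℕ) :
    (∑ w ∈ wordsLT m N, conj (wordOp X w)) * (1 - Phi X) = 1 - Phi X ^ N := by
  classical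
  induction N with
  | zero => simp [wordsLT]
  | succ N ih =>
    have hinj : Set.InjOn (fun x : Fin m × FreeMonoid (Fin m) => FreeMonoid.of x.1 * x.2)
        (((Finset.univ : Finset (Fin m)) ×ˢ wordsLT m N :
          Finset (Fin m × FreeMonoid (Fin m))) : Set (Fin m × FreeMonoid (Fin m))) := by
      rintro ⟨a, v⟩ - ⟨b, w⟩ - h
      have h' : FreeMonoid.toList (FreeMonoid.of a * v) = FreeMonoid.toList (FreeMonoid.of b * w) :=
        congrArg _ h
      simp only [FreeMonoid.toList_of_mul, List.cons.injEq, EmbeddingLike.apply_eq_iff_eq] at h'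
      exact Prod.ext h'.1 h'.2
    have hnot : (1 : FreeMonoid (Fin m)) ∉
        (Finset.univ ×ˢ wordsLT m N).image fun x => FreeMonoid.of x.1 * x.2 := by
      simp only [Finset.mem_image, not_exists, not_and]
      rintro ⟨a, v⟩ - h
      have := congrArg FreeMonoid.length h
      simp at this
    have key : ∑ w ∈ wordsLT m (N + 1), conj (wordOp X w)
        = 1 + Phi X * ∑ w ∈ wordsLT m N, conj (wordOp X w) := by
      rw [wordsLT, Finset.sum_insert hnot, Finset.sum_image hinj, Finset.sum_product, phi_eq,
        Finset.sum_mul]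
      simp [Finset.mul_sum, wordOp]
    rw [key, add_mul, mul_assoc, ih, pow_succ', one_mul, mul_sub, mul_one]
    abel

theorem sum_ofFn_prod {R : Type*} [Ring R] : ∀ {k : ℕ} {ι : Fin k → Type*}
    (W : ∀ i, Finset (ι i)) (f : ∀ i, ι i → R),
    ∑ β ∈ Fintype.piFinset W, (List.ofFn fun i => f i (β i)).prod
      = (List.ofFn fun i => ∑ w ∈ W i, f i w).prod
  | 0, _, W, f => by simp
  | k + 1, ι, W, f => by
      have ih := sum_ofFn_prod (fun i : Fin k => W i.succ) (fun i => f i.succ)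
      rw [List.ofFn_succ, List.prod_cons, ← ih, Finset.sum_mul_sum, ← Finset.sum_product']
      refine Finset.sum_nbij' (fun β => (β 0, fun i => β i.succ)) (fun x => Fin.cons x.1 x.2)
        ?_ ?_ ?_ ?_ ?_
      · intro β hβ
        simp only [Fintype.mem_piFinset] at hβ
        simp [hβ]
      · rintro ⟨a, b⟩ h
        simp only [Finset.mem_product, Fintype.mem_piFinset] at h
        simp only [Fintype.mem_piFinset]
        intro i
        refine Fin.cases ?_ (fun i => ?_) i
        · simpa using h.1
        · simpa using h.2 i
      · intro β _
        exact Fin.cons_self_tail β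
      · rintro ⟨a, b⟩ _
        simp
      · intro β _
        simp [List.ofFn_succ]

theorem prod_nonneg_aux : ∀ {k : ℕ} (A : Fin k → Module.End ℂ (H →L[ℂ] H))
    (_ : ∀ i Y, 0 ≤ Y → 0 ≤ A i Y) {Y : H →L[ℂ] H} (_ : 0 ≤ Y), 0 ≤ (List.ofFn A).prod Y
  | 0, _, _, _, hY => by simpa using hY
  | k + 1, A, hA, Y, hY => by
      rw [List.ofFn_succ, List.prod_cons, Module.End.mul_apply]
      exact hA _ _ (prod_nonneg_aux (fun i => A i.succ) (fun i => hA _) hY)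

theorem prod_le_one_aux : ∀ {k : ℕ} (A B C : Fin k → Module.End ℂ (H →L[ℂ] H))
    (_ : ∀ i Y, 0 ≤ Y → 0 ≤ A i Y) (_ : ∀ i Y, 0 ≤ Y → 0 ≤ C i Y)
    (_ : ∀ i j, i ≠ j → Commute (A i) (B j)) (_ : ∀ i, A i * B i = 1 - C i)
    (_ : ∀ p : Fin k → ℕ, (∀ i, p i ≤ 1) → 0 ≤ (List.ofFn fun i => B i ^ p i).prod 1),
    ((List.ofFn A).prod * (List.ofFn B).prod) 1 ≤ 1
  | 0, _, _, _, _, _, _, _, _ => by simp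
  | k + 1, A, B, C, hA, hC, hAB, hABC, hB => by
      have hB' : ∀ p : Fin k → ℕ, (∀ i, p i ≤ 1) →
          0 ≤ (List.ofFn fun i => B i.succ ^ p i).prod 1 := by
        intro p hp
        have := hB (Fin.cons 0 p) (fun i => Fin.cases (by simp) (fun i => by simpa using hp i) i)
        simpa [List.ofFn_succ] using this
      have ih := prod_le_one_aux (fun i : Fin k => A i.succ) (fun i => B i.succ) (fun i => C i.succ)
        (fun i => hA _) (fun i => hC _) (fun i j h => hAB _ _ (by simpa using h))
        (fun i => hABC _) hB'
      have hpos : 0 ≤ ((List.ofFn fun i : Fin k => A i.succ).prod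
          * (List.ofFn fun i : Fin k => B i.succ).prod) 1 := by
        rw [Module.End.mul_apply]
        refine prod_nonneg_aux _ (fun i => hA _) ?_
        simpa using hB' (fun _ => 1) (fun _ => le_rfl)
      have hcomm : Commute (B 0) (List.ofFn fun i : Fin k => A i.succ).prod := by
        refine Commute.list_prod_right _ _ fun x hx => ?_
        obtain ⟨i, rfl⟩ := (List.mem_ofFn' _ _).1 hx
        exact (hAB _ _ (Fin.succ_ne_zero i)).symm
      have hrw : (List.ofFn A).prod * (List.ofFn B).prod
          = (1 - C 0) * ((List.ofFn fun i : Fin k => A i.succ).prod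
            * (List.ofFn fun i : Fin k => B i.succ).prod) := by
        rw [List.ofFn_succ, List.ofFn_succ, List.prod_cons, List.prod_cons, ← hABC 0, mul_assoc,
          ← mul_assoc _ (B 0), ← hcomm.eq]
        simp only [mul_assoc]
      rw [hrw, Module.End.mul_apply, LinearMap.sub_apply, Module.End.one_apply]
      exact (sub_le_self _ (hC 0 _ hpos)).trans ih

theorem commute_wordOp {T : OpTuple n H} {s : Fin k}
    (w : FreeMonoid (Fin (n s))) (a : H →L[ℂ] H) (ha : ∀ i, Commute (T s i) a) :
    Commute (wordOp (T s) w) a := by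
  induction w using FreeMonoid.inductionOn' with
  | one => simp
  | of_mul j w ih =>
    rw [map_mul]
    exact Commute.mul_left (by simpa [wordOp] using ha j) ih

theorem InPolyball.sum_conj_le {T : OpTuple n H} (hT : InPolyball T) (F : Finset (MultiWord n)) :
    ∑ β ∈ F, conj (multiWordOp T β) (defect T) ≤ 1 := by
  classical
  let N : ℕ := ∑ β ∈ F, ∑ i, (β i).length + 1
  have hsub : F ⊆ Fintype.piFinset fun i => wordsLT (n i) N := by
    intro β hβ
    rw [Fintype.mem_piFinset]
    intro i
    refine mem_wordsLT _ _ (Nat.lt_succ_of_le ?_)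
    exact (Finset.single_le_sum (f := fun i => (β i).length) (fun _ _ => Nat.zero_le _)
      (Finset.mem_univ i)).trans (Finset.single_le_sum
        (f := fun β : MultiWord n => ∑ i, (β i).length) (fun _ _ => Nat.zero_le _) hβ)
  have hdef : 0 ≤ defect T := hT.nonneg _ fun _ => le_rfl
  refine (Finset.sum_le_sum_of_subset_of_nonneg hsub fun β _ _ => conj_nonneg _ hdef).trans ?_
  have h1 : ∑ β ∈ Fintype.piFinset fun i => wordsLT (n i) N, conj (multiWordOp T β)
      = (List.ofFn fun i => ∑ w ∈ wordsLT (n i) N, conj (wordOp (T i) w)).prod := by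
    rw [← sum_ofFn_prod]
    refine Finset.sum_congr rfl fun β _ => ?_
    rw [multiWordOp, map_list_prod, List.map_ofFn]
    rfl
  rw [← LinearMap.sum_apply, h1, defect, ← Module.End.mul_apply, defectMap]
  simp only [pow_one]
  refine prod_le_one_aux _ _ (fun i => Phi (T i) ^ N) ?_ ?_ ?_ ?_ hT.nonneg
  · intro i Y hY
    rw [LinearMap.sum_apply]
    exact Finset.sum_nonneg fun w _ => conj_nonneg _ hY
  · intro i Y hY
    exact phi_pow_nonneg _ _ hY
  · intro i j hij
    refine Commute.sum_left _ _ _ fun w _ => Commute.sub_right (Commute.one_right _) ?_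
    rw [phi_eq]
    refine Commute.sum_right _ _ _ fun a _ => Commute.map ?_ conj
    exact commute_wordOp w _ fun b => hT.commute _ _ hij _ _
  · intro i
    exact sum_wordsLT_mul (T i) N

theorem InPolyball.multiWordOpStar_eq {T : OpTuple n H} (hT : InPolyball T) (β : MultiWord n) :
    multiWordOpStar T β = star (multiWordOp T β) := by
  have hstar : ∀ l : List (H →L[ℂ] H), star l.prod = (l.map star).reverse.prod := by
    intro l
    induction l with
    | nil => simp
    | cons a l ih => simp [ih]
  rw [multiWordOpStar, multiWordOp, hstar, List.map_ofFn]
  refine ((List.reverse_perm _).prod_eq' ?_).symm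
  rw [List.pairwise_reverse, List.pairwise_ofFn]
  intro i j hij
  refine Commute.star_star ?_
  have hij' : i ≠ j := hij.ne
  refine (commute_wordOp _ _ fun a => ?_).symm
  exact (commute_wordOp _ _ fun b => hT.commute _ _ hij'.symm _ _).symm

theorem InPolyball.inner_sqrt {T : OpTuple n H} (hT : InPolyball T) (x : H) :
    ‖CFC.sqrt (defect T) x‖ ^ 2 = (inner ℂ (defect T x) x).re := by
  have hdef : 0 ≤ defect T := hT.nonneg _ fun _ => le_rfl
  have hsa : star (CFC.sqrt (defect T)) = CFC.sqrt (defect T) :=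
    (CFC.sqrt_nonneg (defect T)).isSelfAdjoint
  conv_rhs => rw [← CFC.sqrt_mul_sqrt_self (defect T) hdef]
  rw [mul_apply_eq_comp, ← ContinuousLinearMap.adjoint_inner_right,
    ← ContinuousLinearMap.star_eq_adjoint, hsa]
  exact (inner_self_eq_norm_sq (𝕜 := ℂ) _).symm

/-! ### The noncommutative Berezin kernel -/

/-- The space `\overline{Δ_T(I)(H)}`. -/
abbrev DefectSpace (T : OpTuple n H) : Type _ := (defectRange T).topologicalClosure

theorem InPolyball.sqrt_mem {T : OpTuple n H} (hT : InPolyball T) (x : H) :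
    CFC.sqrt (defect T) x ∈ (defectRange T).topologicalClosure := by
  have hdef : 0 ≤ defect T := hT.nonneg _ fun _ => le_rfl
  have hsa : star (CFC.sqrt (defect T)) = CFC.sqrt (defect T) :=
    (CFC.sqrt_nonneg (defect T)).isSelfAdjoint
  have hsd : star (defect T) = defect T := hdef.isSelfAdjoint
  rw [← Submodule.orthogonal_orthogonal_eq_closure, Submodule.mem_orthogonal]
  intro y hy
  have hy0 : defect T y = 0 := by
    have h := (Submodule.mem_orthogonal' _ _).1 hy (defect T (defect T y)) ⟨_, rfl⟩
    rw [← ContinuousLinearMap.adjoint_inner_left, ← ContinuousLinearMap.star_eq_adjoint, hsd] at h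
    exact inner_self_eq_zero.1 h
  have hs0 : CFC.sqrt (defect T) y = 0 := by
    have := hT.inner_sqrt y
    rw [hy0] at this
    simpa using this
  rw [← ContinuousLinearMap.adjoint_inner_left, ← ContinuousLinearMap.star_eq_adjoint, hsa, hs0,
    inner_zero_left]

/-- The coordinate `h ↦ Δ_T(I)^{1/2} T_{1,β_1}^* ⋯ T_{k,β_k}^* h` of the Berezin kernel. -/
def berezinCoord (T : OpTuple n H) (hT : InPolyball T) (β : MultiWord n) :
    H →L[ℂ] DefectSpace T :=
  (CFC.sqrt (defect T) * multiWordOpStar T β).codRestrict _ fun x => hT.sqrt_mem _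

theorem InPolyball.sum_berezinCoord_le {T : OpTuple n H} (hT : InPolyball T) (x : H)
    (F : Finset (MultiWord n)) : ∑ β ∈ F, ‖berezinCoord T hT β x‖ ^ 2 ≤ ‖x‖ ^ 2 := by
  have h1 : ∀ β, ‖berezinCoord T hT β x‖ ^ 2
      = (inner ℂ (conj (multiWordOp T β) (defect T) x) x).re := by
    intro β
    change ‖CFC.sqrt (defect T) (multiWordOpStar T β x)‖ ^ 2 = _
    rw [hT.inner_sqrt, hT.multiWordOpStar_eq, conj_apply, mul_apply_eq_comp,
      mul_apply_eq_comp, ContinuousLinearMap.star_eq_adjoint,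
      ContinuousLinearMap.adjoint_inner_right]
  have h2 := (ContinuousLinearMap.le_def _ _).1 (hT.sum_conj_le F)
  have h3 := h2.re_inner_nonneg_left x
  simp only [sub_apply, one_apply_eq_self, inner_sub_left,
    map_sub, sum_apply, sum_inner, map_sum] at h3
  have h4 : RCLike.re (inner ℂ x x) = ‖x‖ ^ 2 := inner_self_eq_norm_sq (𝕜 := ℂ) x
  simp only [h1]
  rw [h4] at h3
  exact sub_nonneg.1 h3

/-- The noncommutative Berezin kernel
`K_T h = ∑_β e_{β_1} ⊗ ⋯ ⊗ e_{β_k} ⊗ Δ_T(I)^{1/2} T_{1,β_1}^* ⋯ T_{k,β_k}^* h`. -/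
def berezinKernel (T : OpTuple n H) (hT : InPolyball T) : H →L[ℂ] Fock n (DefectSpace T) :=
  LinearMap.mkContinuous
    { toFun := fun x => ⟨fun β => berezinCoord T hT β x,
        memℓp_gen' (C := ‖x‖ ^ 2) fun F => by simpa using hT.sum_berezinCoord_le x F⟩
      map_add' := fun x y => by ext1; funext β; exact map_add _ x y
      map_smul' := fun c x => by ext1; funext β; exact map_smul (berezinCoord T hT β) c x }
    1 fun x => by
      rw [one_mul]
      refine lp.norm_le_of_forall_sum_le (by simp) (norm_nonneg x) fun F => ?_
      simpa using hT.sum_berezinCoord_le x F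

/-! ### Curvature and Euler characteristic -/

/-- The trace in `[0, ∞]` of a positive operator: `∑_i ⟨A b_i, b_i⟩` over an orthonormal basis
`(b_i)`. The value does not depend on the basis. -/
def opTrace {E : Type*} [NormedAddCommGroup E] [InnerProductSpace ℂ E] [CompleteSpace E]
    (A : E →L[ℂ] E) : ℝ≥0∞ :=
  ∑' i, ENNReal.ofReal
    (inner ℂ (A ((exists_hilbertBasis ℂ E).choose_spec.choose i))
      ((exists_hilbertBasis ℂ E).choose_spec.choose i)).re

/-- The quotient
`trace[K_T^*(P_{q_1} ⊗ ⋯ ⊗ P_{q_k} ⊗ I) K_T] / trace[P_{q_1} ⊗ ⋯ ⊗ P_{q_k}]`. -/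
def curvTerm (T : OpTuple n H) (hT : InPolyball T) (q : Fin k → ℕ) : ℝ :=
  (opTrace (ContinuousLinearMap.adjoint (berezinKernel T hT) ∘L
    degreeProj n (DefectSpace T) q ∘L berezinKernel T hT)).toReal / (opTrace (degreeProj n ℂ q)).toReal

/-- The finite set of all `q ∈ ℤ_+^k` with `q_1 + ⋯ + q_k ≤ m`. -/
def simplexIndex (k m : ℕ) : Finset (Fin k → ℕ) :=
  (Fintype.piFinset fun _ => Finset.range (m + 1)).filter fun q => ∑ i, q i ≤ m

/-- `curv(T)` exists and equals `c`: the defect of `T` is of trace class, and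
`c = lim_m (m+k choose k)⁻¹ ∑_{q_1 + ⋯ + q_k ≤ m} curvTerm T q`. -/
def HasCurvature (T : OpTuple n H) (hT : InPolyball T) (c : ℝ) : Prop :=
  opTrace (defect T) < ∞ ∧
    Tendsto (fun m : ℕ => 1 / ((m + k).choose k : ℝ) * ∑ q ∈ simplexIndex k m, curvTerm T hT q)
      atTop (𝓝 c)

/-- `M_q(T) = span {T_{1,α_1} ⋯ T_{k,α_k} h : |α_i| ≤ q_i, h ∈ Δ_T(I)(H)}`. -/
def eulerSpace (T : OpTuple n H) (q : Fin k → ℕ) : Submodule ℂ H :=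
  Submodule.span ℂ {x | ∃ (α : MultiWord n) (h : H),
    (∀ i, (α i).length ≤ q i) ∧ h ∈ defectRange T ∧ x = multiWordOp T α h}

/-- The quotient `dim M_q(T) / ∏_i (1 + n_i + ⋯ + n_i^{q_i})`. -/
def eulerTerm (T : OpTuple n H) (q : Fin k → ℕ) : ℝ :=
  (Module.finrank ℂ (eulerSpace T q) : ℝ) / ∏ i, ∑ s ∈ Finset.range (q i + 1), (n i : ℝ) ^ s

/-- `χ(T)` exists and equals `c`: the defect of `T` is of finite rank, and `c` is the limit of
`dim M_{q^{(m)}}(T) / ∏_i (1 + n_i + ⋯ + n_i^{q_i^{(m)}})` along every increasing cofinal sequence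
`(q^{(m)})` in `ℤ_+^k`. -/
def HasEulerChar (T : OpTuple n H) (c : ℝ) : Prop :=
  FiniteDimensional ℂ (defectRange T) ∧
    ∀ q : ℕ → Fin k → ℕ, Monotone q → (∀ p, ∃ m, p ≤ q m) →
      Tendsto (fun m => eulerTerm T (q m)) atTop (𝓝 c)

end NCPolyball

end

/-! Positivity and rank one give `Δ = v ⊗ v^*` for some `v ≠ 0`, so everything is governed by the
weights `w(q) = ∑_{|β| = q} ‖T_β v‖²` (`degreeWeight`) and their normalisations `a(q) = w(q) / ∏
n_i^{q_i}`. Both invariants turn out to be averages of the same multi-sequence `a`.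

Curvature: compressing to degree `q` between `K_T^*` and `K_T` gives `∑_{|β| = q} T_β Δ T_β^*`, a
sum of the operators `T_β v ⊗ (T_β v)^*` with trace `w(q)`. Hence the `q`-th curvature term is
exactly `a(q)` (`InPolyball.curvTerm_eq`).

Euler characteristic: purity makes the vectors `T_β v` a Parseval frame of `H`
(`InPolyball.tendsto_sum_inner_sq`), and the grading makes those of different multi-degree
orthogonal (`IsGraded.inner_multiWordOp_eq_zero`). The frame vectors of degree at most `q` are
therefore a Parseval frame of their own span. The squared norms of such a frame add up to the
dimension (`finrank_span_eq_sum_norm_sq`), so `dim M_q = ∑_{s ≤ q} w(s)` exactly, and the Euler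
quotient is the average of `a` over a box with weights `∏ n_i^{s_i}`.

Convergence: each `T_{i,j}` is a contraction, so `w(q + e_i) ≤ n_i w(q)`. Thus `a` is nonnegative
and antitone, and converges along the directed set `ℤ_+^k` to its infimum. Uniform weights on
growing simplices and geometric weights on growing boxes both leave a vanishing share of mass
outside each set `{s ≥ N}`, so both averages tend to that infimum (`tendsto_weighted_average`). -/

noncomputable section

namespace NCPolyball

variable {H : Type*} [NormedAddCommGroup H] [InnerProductSpace ℂ H] [CompleteSpace H]
variable {k : ℕ} {n : Fin k → ℕ}

/-! ### Weighted averages of convergent multi-sequences -/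

open Classical in
/-- Weighted averages of a bounded convergent net converge to its limit, provided that the relative
weight of each tail tends to `1`. -/
theorem tendsto_weighted_average {ι : Type*} [Preorder ι] [IsDirectedOrder ι] [Nonempty ι]
    {a : ι → ℝ} {c M : ℝ} (hM : ∀ s, |a s - c| ≤ M) (ha : Tendsto a atTop (𝓝 c))
    (S : ℕ → Finset ι) (w : ι → ℝ) (hw : ∀ s, 0 ≤ w s) (hpos : ∀ m, 0 < ∑ s ∈ S m, w s)
    (htail : ∀ N : ι, Tendsto
      (fun m => (∑ s ∈ S m with N ≤ s, w s) / ∑ s ∈ S m, w s) atTop (𝓝 1)) :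
    Tendsto (fun m => (∑ s ∈ S m, w s * a s) / ∑ s ∈ S m, w s) atTop (𝓝 c) := by
  have hM0 : 0 ≤ M := (abs_nonneg _).trans (hM (Classical.arbitrary ι))
  rw [Metric.tendsto_atTop]
  intro ε hε
  obtain ⟨N, hN⟩ := eventually_atTop.1
    ((Metric.tendsto_nhds.1 ha (ε / 2) (half_pos hε)))
  -- Off the tail `{s ≥ N}` only the bound `M` is available; it costs `M` times the relative weight
  -- there, which is eventually below `ε / 2`.
  have h1 : Tendsto (fun m => M * (1 - (∑ s ∈ S m with N ≤ s, w s) / ∑ s ∈ S m, w s)) atTop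
      (𝓝 (M * (1 - 1))) := (tendsto_const_nhds.sub (htail N)).const_mul M
  rw [sub_self, mul_zero] at h1
  obtain ⟨m₀, hm₀⟩ := eventually_atTop.1 (h1.eventually_lt_const (half_pos hε))
  refine ⟨m₀, fun m hm => ?_⟩
  have hW := hpos m
  have h2 := hm₀ m hm
  rw [one_sub_div hW.ne', mul_div_assoc', div_lt_iff₀ hW] at h2
  have hsplit := Finset.sum_filter_add_sum_filter_not (S m) (fun s => N ≤ s) w
  have key : |∑ s ∈ S m, w s * (a s - c)| ≤
      (ε / 2) * (∑ s ∈ S m with N ≤ s, w s) + M * ∑ s ∈ S m with ¬ N ≤ s, w s := by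
    refine (Finset.abs_sum_le_sum_abs _ _).trans ?_
    rw [← Finset.sum_filter_add_sum_filter_not (S m) (fun s => N ≤ s), Finset.mul_sum,
      Finset.mul_sum]
    refine add_le_add (Finset.sum_le_sum fun s hs => ?_) (Finset.sum_le_sum fun s _ => ?_)
    · rw [abs_mul, abs_of_nonneg (hw s), mul_comm]
      have := hN s (Finset.mem_filter.1 hs).2
      rw [Real.dist_eq] at this
      exact mul_le_mul_of_nonneg_right this.le (hw s)
    · rw [abs_mul, abs_of_nonneg (hw s), mul_comm]
      exact mul_le_mul_of_nonneg_right (hM s) (hw s)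
  have hgood : ∑ s ∈ S m with N ≤ s, w s ≤ ∑ s ∈ S m, w s := by
    rw [← hsplit]
    exact le_add_of_nonneg_right (Finset.sum_nonneg fun s _ => hw s)
  have hrw : (∑ s ∈ S m, w s * a s) / ∑ s ∈ S m, w s - c
      = (∑ s ∈ S m, w s * (a s - c)) / ∑ s ∈ S m, w s := by
    rw [div_sub' hW.ne']
    congr 1
    simp only [mul_sub, Finset.sum_sub_distrib, ← Finset.sum_mul]
  rw [Real.dist_eq, hrw, abs_div, abs_of_pos hW, div_lt_iff₀ hW]
  nlinarith

theorem mem_simplexIndex {m : ℕ} {q : Fin k → ℕ} : q ∈ simplexIndex k m ↔ ∑ i, q i ≤ m := by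
  simp only [simplexIndex, Finset.mem_filter, Fintype.mem_piFinset, Finset.mem_range,
    and_iff_right_iff_imp]
  intro h i
  exact Nat.lt_succ_of_le ((Finset.single_le_sum (f := q) (fun _ _ => Nat.zero_le _)
    (Finset.mem_univ i)).trans h)

/-- Fixing the first coordinate leaves a simplex of one dimension less and size `j = m - q 0`;
summing over `j` is the hockey-stick identity. -/
theorem card_simplexIndex (k m : ℕ) : (simplexIndex k m).card = (m + k).choose k := by
  induction k generalizing m with
  | zero =>
    have : simplexIndex 0 m = Finset.univ := by
      ext q; simpa [mem_simplexIndex] using Subsingleton.elim _ _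
    simp [this]
  | succ k ih =>
    have h : (simplexIndex (k + 1) m).card
        = ((Finset.range (m + 1)).sigma fun j => simplexIndex k j).card := by
      -- On the simplex the first component equals `m - q 0`. Written as tail sum plus slack, it
      -- visibly dominates the tail sum.
      refine Finset.card_nbij' (fun q => ⟨∑ i : Fin k, q i.succ + (m - ∑ i, q i), fun i => q i.succ⟩)
        (fun x => Fin.cons (m - x.1) x.2) ?_ ?_ ?_ ?_
      · intro q hq
        rw [Finset.mem_coe, mem_simplexIndex, Fin.sum_univ_succ] at hq
        simp only [Finset.coe_sigma, Set.mem_sigma_iff, Finset.mem_coe, Finset.mem_range,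
          mem_simplexIndex, Fin.sum_univ_succ]
        omega
      · rintro ⟨j, q⟩ hq
        simp only [Finset.coe_sigma, Set.mem_sigma_iff, Finset.mem_coe, Finset.mem_range,
          mem_simplexIndex] at hq
        simp only [Finset.mem_coe, mem_simplexIndex, Fin.sum_univ_succ, Fin.cons_zero,
          Fin.cons_succ]
        omega
      · intro q hq
        rw [Finset.mem_coe, mem_simplexIndex, Fin.sum_univ_succ] at hq
        funext i
        refine Fin.cases ?_ (fun i => ?_) i
        · simp only [Fin.sum_univ_succ, Fin.cons_zero]
          omega
        · simp
      · rintro ⟨j, q⟩ hq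
        simp only [Finset.coe_sigma, Set.mem_sigma_iff, Finset.mem_coe, Finset.mem_range,
          mem_simplexIndex] at hq
        simp only [Fin.sum_univ_succ, Fin.cons_zero, Fin.cons_succ, Sigma.mk.injEq, heq_eq_eq,
          and_true]
        omega
    rw [h, Finset.card_sigma]
    simp only [ih]
    rw [Nat.sum_range_add_choose]
    congr 1

open Classical in
-- Translation by `N` identifies the points above `N` with the simplex of size `m - ∑ N i`.
theorem card_simplexIndex_filter_le (N : Fin k → ℕ) {m : ℕ} (hm : ∑ i, N i ≤ m) :
    ((simplexIndex k m).filter fun q => N ≤ q).card = (m - ∑ i, N i + k).choose k := by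
  rw [← card_simplexIndex]
  refine Finset.card_nbij' (fun q => q - N) (fun q => q + N) ?_ ?_ ?_ ?_
  · intro q hq
    simp only [Finset.coe_filter, Set.mem_ofPred_eq, mem_simplexIndex] at hq
    simp only [Finset.mem_coe, mem_simplexIndex, Pi.sub_apply]
    have : ∑ i, (q i - N i) + ∑ i, N i = ∑ i, q i := by
      rw [← Finset.sum_add_distrib]
      exact Finset.sum_congr rfl fun i _ => Nat.sub_add_cancel (hq.2 i)
    omega
  · intro q hq
    simp only [Finset.mem_coe, mem_simplexIndex] at hq
    simp only [Finset.coe_filter, Set.mem_ofPred_eq, mem_simplexIndex, Pi.add_apply,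
      Finset.sum_add_distrib]
    exact ⟨by omega, fun i => Nat.le_add_left _ _⟩
  · intro q hq
    simp only [Finset.coe_filter, Set.mem_ofPred_eq] at hq
    exact tsub_add_cancel_of_le hq.2
  · intro q _
    exact add_tsub_cancel_right q N

/-- After cancelling `k!` the ratio is a product of `k` factors, a fixed number, each tending to
`1`. -/
theorem tendsto_choose_div_choose (k M : ℕ) :
    Tendsto (fun m : ℕ => ((m - M + k).choose k : ℝ) / ((m + k).choose k : ℝ)) atTop (𝓝 1) := by
  have h : ∀ j : ℕ, Tendsto (fun m : ℕ => ((m + 1 + j : ℕ) : ℝ) / ((m + M + 1 + j : ℕ) : ℝ)) atTop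
      (𝓝 1) := by
    intro j
    have h1 : Tendsto (fun m : ℕ => 1 - (M : ℝ) / ((m + M + 1 + j : ℕ) : ℝ)) atTop (𝓝 (1 - 0)) := by
      refine tendsto_const_nhds.sub (Tendsto.div_atTop tendsto_const_nhds ?_)
      refine tendsto_natCast_atTop_atTop.comp (tendsto_atTop_mono (fun m => ?_) tendsto_id)
      simp only [id]
      omega
    rw [sub_zero] at h1
    refine h1.congr fun m => ?_
    have : ((m + M + 1 + j : ℕ) : ℝ) ≠ 0 := by positivity
    rw [one_sub_div this]
    congr 1
    push_cast
    ring
  have h2 := tendsto_finsetProd (Finset.range k) fun j _ => h j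
  simp only [Finset.prod_const_one] at h2
  -- Replacing `m` by `m + M` removes the truncated subtraction.
  rw [← tendsto_add_atTop_iff_nat M]
  refine h2.congr fun m => ?_
  have e : ∀ a : ℕ, ((a + k).choose k : ℝ)
      = (∏ j ∈ Finset.range k, ((a + 1 + j : ℕ) : ℝ)) / (k.factorial : ℝ) := by
    intro a
    rw [eq_div_iff (by positivity), mul_comm]
    have := Nat.ascFactorial_eq_factorial_mul_choose (a) k
    rw [Nat.ascFactorial_eq_prod_range] at this
    exact_mod_cast this.symm
  rw [Nat.add_sub_cancel, e, e, div_div_div_cancel_right₀ (by positivity), Finset.prod_div_distrib]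

/-- Averages over large simplices of a bounded convergent multi-sequence. -/
theorem tendsto_simplex_average {a : (Fin k → ℕ) → ℝ} {c M : ℝ} (hM : ∀ s, |a s - c| ≤ M)
    (ha : Tendsto a atTop (𝓝 c)) :
    Tendsto (fun m : ℕ => 1 / ((m + k).choose k : ℝ) * ∑ q ∈ simplexIndex k m, a q)
      atTop (𝓝 c) := by
  classical
  have hcard : ∀ m, ∑ _s ∈ simplexIndex k m, (1 : ℝ) = ((m + k).choose k : ℝ) := by
    intro m; simp [card_simplexIndex]
  have h := tendsto_weighted_average hM ha (simplexIndex k) (fun _ => 1) (fun _ => zero_le_one)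
    (fun m => by
      rw [hcard]
      exact_mod_cast Nat.choose_pos (Nat.le_add_left _ _)) ?_
  · refine h.congr fun m => ?_
    rw [hcard, one_div_mul_eq_div]
    simp
  · intro N
    refine (tendsto_choose_div_choose k (∑ i, N i)).congr' ?_
    filter_upwards [eventually_ge_atTop (∑ i, N i)] with m hm
    rw [hcard]
    congr 1
    rw [Finset.sum_const, nsmul_one, Nat.cast_inj, ← card_simplexIndex_filter_le N hm]

/-- The lattice points of the box `[0, q_1] × ⋯ × [0, q_k]`. -/
def boxIndex (q : Fin k → ℕ) : Finset (Fin k → ℕ) :=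
  Fintype.piFinset fun i => Finset.range (q i + 1)

theorem mem_boxIndex {q s : Fin k → ℕ} : s ∈ boxIndex q ↔ s ≤ q := by
  simp [boxIndex, Pi.le_def]

theorem sum_boxIndex (q : Fin k → ℕ) (b : Fin k → ℝ) :
    ∑ s ∈ boxIndex q, ∏ i, b i ^ s i = ∏ i, ∑ t ∈ Finset.range (q i + 1), b i ^ t :=
  (Finset.prod_univ_sum _ _).symm

/-- Geometrically weighted averages over large boxes of a bounded convergent multi-sequence. -/
theorem tendsto_box_average {a : (Fin k → ℕ) → ℝ} {c M : ℝ} (hM : ∀ s, |a s - c| ≤ M)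
    (ha : Tendsto a atTop (𝓝 c)) {b : Fin k → ℝ} (hb : ∀ i, 1 ≤ b i) {q : ℕ → Fin k → ℕ}
    (hq : Tendsto q atTop atTop) :
    Tendsto (fun m => (∑ s ∈ boxIndex (q m), (∏ i, b i ^ s i) * a s) /
      ∏ i, ∑ t ∈ Finset.range (q m i + 1), b i ^ t) atTop (𝓝 c) := by
  classical
  have hb0 : ∀ i, 0 < b i := fun i => zero_lt_one.trans_le (hb i)
  have hG : ∀ i (j : ℕ), 0 < ∑ t ∈ Finset.range (j + 1), b i ^ t := fun i j =>
    Finset.sum_pos (fun t _ => pow_pos (hb0 i) t) ⟨0, by simp⟩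
  have h := tendsto_weighted_average hM ha (fun m => boxIndex (q m)) (fun s => ∏ i, b i ^ s i)
    (fun s => Finset.prod_nonneg fun i _ => (pow_pos (hb0 i) _).le)
    (fun m => by rw [sum_boxIndex]; exact Finset.prod_pos fun i _ => hG i _) ?_
  · simpa only [sum_boxIndex] using h
  · intro N
    have hqi : ∀ i, Tendsto (fun m => q m i) atTop atTop := fun i =>
      tendsto_atTop.2 fun j => (tendsto_atTop.1 hq (fun _ => j)).mono fun m hm => hm i
    -- Weights, box and tail are all products over the coordinates, so the tail ratio is a product
    -- of one-dimensional ratios. In each of these the omitted part is a fixed finite sum, while the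
    -- total diverges because `b i ≥ 1`.
    have hfac : ∀ i, Tendsto (fun m => (∑ t ∈ (Finset.range (q m i + 1)).filter (fun t => N i ≤ t),
        b i ^ t) / ∑ t ∈ Finset.range (q m i + 1), b i ^ t) atTop (𝓝 1) := by
      intro i
      have hinf : Tendsto (fun j : ℕ => ∑ t ∈ Finset.range (j + 1), b i ^ t) atTop atTop := by
        refine tendsto_atTop_mono (fun j => ?_) tendsto_natCast_atTop_atTop
        calc (j : ℝ) ≤ ∑ t ∈ Finset.range (j + 1), (1 : ℝ) := by simp
          _ ≤ _ := Finset.sum_le_sum fun t _ => one_le_pow₀ (hb i)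
      have h1 : Tendsto (fun m => 1 - (∑ t ∈ Finset.range (N i), b i ^ t) /
          ∑ t ∈ Finset.range (q m i + 1), b i ^ t) atTop (𝓝 (1 - 0)) :=
        tendsto_const_nhds.sub (Tendsto.div_atTop tendsto_const_nhds (hinf.comp (hqi i)))
      rw [sub_zero] at h1
      refine h1.congr' ?_
      filter_upwards [tendsto_atTop.1 (hqi i) (N i)] with m hm
      rw [one_sub_div (hG i _).ne']
      congr 1
      rw [← Finset.sum_filter_add_sum_filter_not (Finset.range (q m i + 1)) (fun t => N i ≤ t),
        add_sub_assoc, add_eq_left, sub_eq_zero]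
      refine Finset.sum_congr ?_ fun _ _ => rfl
      ext t
      simp only [Finset.mem_filter, Finset.mem_range]
      omega
    have h2 := tendsto_finsetProd Finset.univ fun i _ => hfac i
    simp only [Finset.prod_const_one] at h2
    refine h2.congr fun m => ?_
    rw [sum_boxIndex, Finset.prod_div_distrib, Finset.prod_univ_sum]
    congr 1
    refine Finset.sum_congr ?_ fun _ _ => rfl
    ext s
    simp only [Fintype.mem_piFinset, Finset.mem_filter, Finset.mem_range, boxIndex, Pi.le_def,
      forall_and]

/-- A multi-sequence that decreases along the coordinate directions is antitone. -/
theorem antitone_of_add_single_le {a : (Fin k → ℕ) → ℝ}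
    (h : ∀ q i, a (q + Pi.single i 1) ≤ a q) : Antitone a := by
  have key : ∀ (N : ℕ) (q d : Fin k → ℕ), ∑ i, d i = N → a (q + d) ≤ a q := by
    intro N
    induction N with
    | zero =>
      intro q d hd
      have : d = 0 := by
        funext i
        exact Finset.sum_eq_zero_iff.1 hd i (Finset.mem_univ i)
      simp [this]
    | succ N ih =>
      intro q d hd
      obtain ⟨i, hi⟩ : ∃ i, d i ≠ 0 := by
        by_contra! hc
        simp [hc] at hd
      have hle : Pi.single i 1 ≤ d := by
        intro l
        by_cases hl : l = i
        · subst hl; simp; omega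
        · simp [hl]
      obtain ⟨e, rfl⟩ := exists_add_of_le hle
      have he : ∑ i, e i = N := by
        simp only [Pi.add_apply, Finset.sum_add_distrib, Finset.sum_pi_single',
          Finset.mem_univ, if_true] at hd
        omega
      rw [← add_assoc]
      exact (ih _ e he).trans (h q i)
  intro q r hqr
  obtain ⟨d, rfl⟩ := exists_add_of_le hqr
  exact key _ q d rfl

open InnerProductSpace (rankOne)

/-! ### Rank one operators and traces -/

theorem conj_rankOne (a : H →L[ℂ] H) (x y : H) :
    conj a (rankOne ℂ x y) = rankOne ℂ (a x) (a y) := by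
  ext z
  simp [conj_apply, mul_apply_eq_comp, ContinuousLinearMap.star_eq_adjoint,
    ContinuousLinearMap.adjoint_inner_right]

theorem re_inner_rankOne_self {E : Type*} [NormedAddCommGroup E] [InnerProductSpace ℂ E] (u x : E) :
    (inner ℂ (rankOne ℂ u u x) x).re = ‖inner ℂ u x‖ ^ 2 := by
  have := inner_mul_symm_re_eq_norm (𝕜 := ℂ) x u
  rw [norm_mul, norm_inner_symm x u, ← sq] at this
  rw [InnerProductSpace.inner_left_rankOne_apply]
  exact this

theorem hasSum_norm_inner_sq {E ι : Type*} [NormedAddCommGroup E] [InnerProductSpace ℂ E]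
    (b : HilbertBasis ι ℂ E) (u : E) : HasSum (fun i => ‖inner ℂ u (b i)‖ ^ 2) (‖u‖ ^ 2) := by
  have h := Complex.hasSum_re (b.hasSum_inner_mul_inner u u)
  have h2 : (inner ℂ u u : ℂ).re = ‖u‖ ^ 2 := inner_self_eq_norm_sq (𝕜 := ℂ) u
  rw [h2] at h
  refine h.congr_fun fun i => ?_
  have := inner_mul_symm_re_eq_norm (𝕜 := ℂ) u (b i)
  rw [norm_mul, norm_inner_symm (b i) u, ← sq] at this
  exact this.symm

/-- Parseval's identity gives `‖u j‖²` for each summand in any Hilbert basis, so the basis chosen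
inside `opTrace` is immaterial. -/
theorem opTrace_sum_rankOne {E ι : Type*} [NormedAddCommGroup E] [InnerProductSpace ℂ E]
    [CompleteSpace E] (s : Finset ι) (u : ι → E) :
    opTrace (∑ j ∈ s, rankOne ℂ (u j) (u j)) = ENNReal.ofReal (∑ j ∈ s, ‖u j‖ ^ 2) := by
  have hb := (exists_hilbertBasis ℂ E).choose_spec.choose_spec
  unfold opTrace
  set b := (exists_hilbertBasis ℂ E).choose_spec.choose
  have h : HasSum (fun i => (inner ℂ ((∑ j ∈ s, rankOne ℂ (u j) (u j)) (b i)) (b i)).re)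
      (∑ j ∈ s, ‖u j‖ ^ 2) := by
    simp only [sum_apply, sum_inner, Complex.re_sum, re_inner_rankOne_self]
    exact hasSum_sum fun j _ => hasSum_norm_inner_sq b (u j)
  rw [← h.tsum_eq, ENNReal.ofReal_tsum_of_nonneg _ h.summable]
  intro i
  simp only [sum_apply, sum_inner, Complex.re_sum, re_inner_rankOne_self]
  positivity

/-- A finite family that satisfies Parseval's identity on its span computes the dimension of the
span. -/
theorem finrank_span_eq_sum_norm_sq {E ι : Type*} [NormedAddCommGroup E] [InnerProductSpace ℂ E]
    (s : Finset ι) (u : ι → E)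
    (h : ∀ x ∈ Submodule.span ℂ (u '' s), ∑ j ∈ s, ‖inner ℂ (u j) x‖ ^ 2 = ‖x‖ ^ 2) :
    (Module.finrank ℂ (Submodule.span ℂ (u '' s)) : ℝ) = ∑ j ∈ s, ‖u j‖ ^ 2 := by
  set V := Submodule.span ℂ (u '' s) with hV
  have : FiniteDimensional ℂ V := FiniteDimensional.span_of_finite ℂ (s.finite_toSet.image u)
  let b := stdOrthonormalBasis ℂ V
  have hb : ∀ i, ‖((b i : V) : E)‖ = 1 := fun i => b.norm_eq_one i
  calc (Module.finrank ℂ V : ℝ) = ∑ i, ‖((b i : V) : E)‖ ^ 2 := by simp [hb]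
    -- Both sides are the same double sum of `|⟨u_j, b_i⟩|²`: over `j` first by the frame
    -- hypothesis, over `i` first by Parseval for the orthonormal basis.
    _ = ∑ i, ∑ j ∈ s, ‖inner ℂ (u j) ((b i : V) : E)‖ ^ 2 :=
        Finset.sum_congr rfl fun i _ => (h _ (b i).2).symm
    _ = ∑ j ∈ s, ∑ i, ‖inner ℂ (u j) ((b i : V) : E)‖ ^ 2 := Finset.sum_comm
    _ = ∑ j ∈ s, ‖u j‖ ^ 2 := by
        refine Finset.sum_congr rfl fun j hj => ?_
        exact b.sum_sq_norm_inner_left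
          (⟨u j, Submodule.subset_span (Set.mem_image_of_mem u hj)⟩ : V)

/-! ### Words of given length -/

/-- The words of length `p`. -/
def wordsOfLength (m p : ℕ) : Finset (FreeMonoid (Fin m)) :=
  (Finset.univ : Finset (List.Vector (Fin m) p)).map
    ⟨fun w : List.Vector (Fin m) p => FreeMonoid.ofList w.1, fun _ _ h => Subtype.ext h⟩

theorem mem_wordsOfLength {m p : ℕ} {w : FreeMonoid (Fin m)} :
    w ∈ wordsOfLength m p ↔ w.length = p := by
  simp only [wordsOfLength, Finset.mem_map, Finset.mem_univ, true_and]
  exact ⟨fun ⟨a, ha⟩ => ha ▸ a.2, fun h => ⟨⟨w.toList, h⟩, rfl⟩⟩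

theorem card_wordsOfLength (m p : ℕ) : (wordsOfLength m p).card = m ^ p := by
  rw [wordsOfLength, Finset.card_map, Finset.card_univ, card_vector, Fintype.card_fin]

/-- The multi-degree `(|β_1|, …, |β_k|)`. -/
def multiDegree (β : MultiWord n) : Fin k → ℕ := fun i => (β i).length

/-- The multi-words of multi-degree `q`. -/
def wordsOfDegree (n : Fin k → ℕ) (q : Fin k → ℕ) : Finset (MultiWord n) :=
  Fintype.piFinset fun i => wordsOfLength (n i) (q i)

theorem mem_wordsOfDegree {q : Fin k → ℕ} {β : MultiWord n} :
    β ∈ wordsOfDegree n q ↔ multiDegree β = q := by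
  simp [wordsOfDegree, mem_wordsOfLength, multiDegree, funext_iff]

theorem card_wordsOfDegree (q : Fin k → ℕ) : (wordsOfDegree n q).card = ∏ i, n i ^ q i := by
  simp [wordsOfDegree, card_wordsOfLength]

open Classical in
/-- The multi-words of multi-degree at most `q`. -/
def wordsUpTo (n : Fin k → ℕ) (q : Fin k → ℕ) : Finset (MultiWord n) :=
  (boxIndex q).biUnion (wordsOfDegree n)

theorem mem_wordsUpTo {q : Fin k → ℕ} {β : MultiWord n} :
    β ∈ wordsUpTo n q ↔ multiDegree β ≤ q := by
  simp [wordsUpTo, mem_wordsOfDegree, mem_boxIndex]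

theorem sum_wordsUpTo (q : Fin k → ℕ) (f : MultiWord n → ℝ) :
    ∑ β ∈ wordsUpTo n q, f β = ∑ s ∈ boxIndex q, ∑ β ∈ wordsOfDegree n s, f β := by
  classical
  refine Finset.sum_biUnion fun s _ t _ hst => ?_
  rw [Function.onFun, Finset.disjoint_left]
  intro β h1 h2
  exact hst ((mem_wordsOfDegree.1 h1).symm.trans (mem_wordsOfDegree.1 h2))

/-! ### Ordered products -/

/-- The factor `a` is moved to the right past the earlier factors until it meets the `i`-th. This is
how a letter of the `i`-th alphabet is absorbed into the `i`-th word of an ordered product. -/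
theorem mul_prod_ofFn {M : Type*} [Monoid M] : ∀ {k : ℕ} (f : Fin k → M) (i : Fin k) (a : M)
    (_ : ∀ l, l ≠ i → Commute a (f l)),
    a * (List.ofFn f).prod = (List.ofFn (Function.update f i (a * f i))).prod
  | 0, _, i, _, _ => i.elim0
  | k + 1, f, i, a, h => by
      rw [List.ofFn_succ, List.ofFn_succ, List.prod_cons, List.prod_cons]
      induction i using Fin.cases with
      | zero => simp [mul_assoc]
      | succ i =>
        have ih := mul_prod_ofFn (fun l : Fin k => f l.succ) i a
          (fun l hl => h _ (by simpa using hl))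
        rw [← mul_assoc, (h 0 (Fin.succ_ne_zero i).symm).eq, mul_assoc, ih,
          Function.update_of_ne (Fin.succ_ne_zero i).symm]
        congr 3
        funext l
        by_cases hl : l = i
        · subst hl; simp
        · rw [Function.update_of_ne hl, Function.update_of_ne (by simpa using hl)]

theorem prod_ofFn_intertwine {R : Type*} [Ring R] [Algebra ℂ R] (u : R) :
    ∀ {k : ℕ} (f : Fin k → R) (c : Fin k → ℂ) (_ : ∀ i, u * f i = c i • (f i * u)),
    u * (List.ofFn f).prod = (∏ i, c i) • ((List.ofFn f).prod * u)
  | 0, _, _, _ => by simp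
  | k + 1, f, c, h => by
      have ih := prod_ofFn_intertwine u (fun i : Fin k => f i.succ) (fun i => c i.succ)
        (fun i => h _)
      rw [List.ofFn_succ, List.prod_cons, ← mul_assoc, h 0, smul_mul_assoc, mul_assoc, ih,
        Fin.prod_univ_succ, mul_smul_comm, smul_smul, mul_assoc]

theorem InPolyball.mul_multiWordOp {T : OpTuple n H} (hT : InPolyball T) (i : Fin k)
    (j : Fin (n i)) (β : MultiWord n) :
    T i j * multiWordOp T β
      = multiWordOp T (Function.update β i (FreeMonoid.of j * β i)) := by
  rw [multiWordOp, mul_prod_ofFn _ i, multiWordOp]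
  · congr 2
    funext l
    by_cases hl : l = i
    · subst hl; simp [wordOp]
    · simp [Function.update_of_ne hl]
  · intro l hl
    exact (commute_wordOp _ _ fun b => hT.commute _ _ hl _ _).symm

theorem defectMap_single (T : OpTuple n H) (i : Fin k) :
    defectMap T (Pi.single i 1) = 1 - Phi (T i) := by
  have h := mul_prod_ofFn (fun _ : Fin k => (1 : Module.End ℂ (H →L[ℂ] H))) i (1 - Phi (T i))
    (fun _ _ => Commute.one_right _)
  rw [List.ofFn_const, List.prod_replicate, one_pow, mul_one] at h
  rw [h, defectMap]
  congr 2
  funext l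
  by_cases hl : l = i
  · subst hl; simp
  · simp [hl]

theorem InPolyball.phi_one_le {T : OpTuple n H} (hT : InPolyball T) (i : Fin k) :
    Phi (T i) 1 ≤ 1 := by
  have h := hT.nonneg (Pi.single i 1) fun l => by
    by_cases hl : l = i
    · subst hl; simp
    · simp [hl]
  rw [defectMap_single] at h
  simpa using h

/-- `T_{i,j} T_{i,j}^*` is one of the positive summands of `Φ_{T_i}(1) ≤ 1`, so the adjoint is a
contraction. -/
theorem InPolyball.norm_apply_le {T : OpTuple n H} (hT : InPolyball T) (i : Fin k)
    (j : Fin (n i)) (x : H) : ‖T i j x‖ ≤ ‖x‖ := by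
  have h1 : conj (T i j) 1 ≤ 1 := by
    refine le_trans ?_ (hT.phi_one_le i)
    rw [phi_eq, LinearMap.sum_apply]
    exact Finset.single_le_sum (f := fun j => conj (T i j) 1)
      (fun j _ => conj_nonneg _ zero_le_one) (Finset.mem_univ j)
  have h2 : ‖star (T i j)‖ ≤ 1 := by
    refine ContinuousLinearMap.opNorm_le_bound _ zero_le_one fun y => ?_
    rw [one_mul]
    have h3 := ((ContinuousLinearMap.le_def _ _).1 h1).re_inner_nonneg_left y
    rw [conj_apply, mul_one, sub_apply, one_apply_eq_self, inner_sub_left, map_sub,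
      mul_apply_eq_comp, ← ContinuousLinearMap.adjoint_inner_right, inner_self_eq_norm_sq,
      ← ContinuousLinearMap.star_eq_adjoint, inner_self_eq_norm_sq, sub_nonneg] at h3
    exact (sq_le_sq₀ (norm_nonneg _) (norm_nonneg _)).1 h3
  rw [norm_star] at h2
  simpa using (T i j).le_of_opNorm_le h2 x

/-! ### Consequences of purity -/

/-- Lower counterpart of `prod_le_one_aux`. Let `X` be the value at `1` of the product over the
remaining indices; the full product gives `X - C 0 X`. As `X ≤ 1` and `C 0` is positive, `C 0 X ≤ C
0 1`, so each index costs at most `C i 1`. -/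
theorem one_sub_sum_le_prod : ∀ {k : ℕ} (A B C : Fin k → Module.End ℂ (H →L[ℂ] H))
    (_ : ∀ i Y, 0 ≤ Y → 0 ≤ A i Y) (_ : ∀ i Y, 0 ≤ Y → 0 ≤ C i Y)
    (_ : ∀ i j, i ≠ j → Commute (A i) (B j)) (_ : ∀ i, A i * B i = 1 - C i)
    (_ : ∀ p : Fin k → ℕ, (∀ i, p i ≤ 1) → 0 ≤ (List.ofFn fun i => B i ^ p i).prod 1),
    1 - ∑ i, C i 1 ≤ ((List.ofFn A).prod * (List.ofFn B).prod) 1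
  | 0, _, _, _, _, _, _, _, _ => by simp
  | k + 1, A, B, C, hA, hC, hAB, hABC, hB => by
      have hB' : ∀ p : Fin k → ℕ, (∀ i, p i ≤ 1) →
          0 ≤ (List.ofFn fun i => B i.succ ^ p i).prod 1 := by
        intro p hp
        have := hB (Fin.cons 0 p) (fun i => Fin.cases (by simp) (fun i => by simpa using hp i) i)
        simpa [List.ofFn_succ] using this
      have hAB' : ∀ i j : Fin k, i ≠ j → Commute (A i.succ) (B j.succ) :=
        fun i j h => hAB _ _ (by simpa using h)
      have ih := one_sub_sum_le_prod (fun i : Fin k => A i.succ) (fun i => B i.succ)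
        (fun i => C i.succ) (fun i => hA _) (fun i => hC _) hAB' (fun i => hABC _) hB'
      have hle := prod_le_one_aux (fun i : Fin k => A i.succ) (fun i => B i.succ)
        (fun i => C i.succ) (fun i => hA _) (fun i => hC _) hAB' (fun i => hABC _) hB'
      have hcomm : Commute (B 0) (List.ofFn fun i : Fin k => A i.succ).prod := by
        refine Commute.list_prod_right _ _ fun x hx => ?_
        obtain ⟨i, rfl⟩ := (List.mem_ofFn' _ _).1 hx
        exact (hAB _ _ (Fin.succ_ne_zero i)).symm
      have hrw : (List.ofFn A).prod * (List.ofFn B).prod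
          = (1 - C 0) * ((List.ofFn fun i : Fin k => A i.succ).prod
            * (List.ofFn fun i : Fin k => B i.succ).prod) := by
        rw [List.ofFn_succ, List.ofFn_succ, List.prod_cons, List.prod_cons, ← hABC 0, mul_assoc,
          ← mul_assoc _ (B 0), ← hcomm.eq]
        simp only [mul_assoc]
      have h0 := hC 0 _ (sub_nonneg.2 hle)
      rw [map_sub, sub_nonneg] at h0
      rw [hrw, Module.End.mul_apply, LinearMap.sub_apply, Module.End.one_apply,
        Fin.sum_univ_succ, add_comm, ← sub_sub]
      exact sub_le_sub ih h0

/-- The multi-words all of whose components have length `< N`. -/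
def multiWordsLT (n : Fin k → ℕ) (N : ℕ) : Finset (MultiWord n) :=
  Fintype.piFinset fun i => wordsLT (n i) N

/-- For each `i` the sum over words of length below `N` telescopes against `1 - Φ_{T_i}` to `1 -
Φ_{T_i}^N`. Purity makes the error on the left vanish strongly as `N → ∞`. -/
theorem InPolyball.one_sub_le_sum_conj {T : OpTuple n H} (hT : InPolyball T) (N : ℕ) :
    1 - ∑ i, (Phi (T i) ^ N) 1 ≤ ∑ β ∈ multiWordsLT n N, conj (multiWordOp T β) (defect T) := by
  classical
  have h1 : ∑ β ∈ multiWordsLT n N, conj (multiWordOp T β)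
      = (List.ofFn fun i => ∑ w ∈ wordsLT (n i) N, conj (wordOp (T i) w)).prod := by
    rw [← sum_ofFn_prod]
    refine Finset.sum_congr rfl fun β _ => ?_
    rw [multiWordOp, map_list_prod, List.map_ofFn]
    rfl
  rw [← LinearMap.sum_apply (multiWordsLT n N), h1, defect, ← Module.End.mul_apply, defectMap]
  simp only [pow_one]
  refine one_sub_sum_le_prod _ _ (fun i => Phi (T i) ^ N) ?_ ?_ ?_ ?_ hT.nonneg
  · intro i Y hY
    rw [LinearMap.sum_apply]
    exact Finset.sum_nonneg fun w _ => conj_nonneg _ hY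
  · intro i Y hY
    exact phi_pow_nonneg _ _ hY
  · intro i j hij
    refine Commute.sum_left _ _ _ fun w _ => Commute.sub_right (Commute.one_right _) ?_
    rw [phi_eq]
    refine Commute.sum_right _ _ _ fun a _ => Commute.map ?_ conj
    exact commute_wordOp w _ fun b => hT.commute _ _ hij _ _
  · intro i
    exact sum_wordsLT_mul (T i) N

/-- For a pure tuple with defect `v ⊗ v^*` the vectors `T_β v` form a Parseval frame. -/
theorem InPolyball.tendsto_sum_inner_sq {T : OpTuple n H} (hT : InPolyball T) (hpure : IsPure T)
    {v : H} (hv : defect T = rankOne ℂ v v) (x : H) :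
    Tendsto (fun N => ∑ β ∈ multiWordsLT n N, ‖inner ℂ (multiWordOp T β v) x‖ ^ 2) atTop
      (𝓝 (‖x‖ ^ 2)) := by
  have hre : ∀ N, (inner ℂ ((∑ β ∈ multiWordsLT n N, conj (multiWordOp T β) (defect T)) x) x).re
      = ∑ β ∈ multiWordsLT n N, ‖inner ℂ (multiWordOp T β v) x‖ ^ 2 := by
    intro N
    simp only [hv, conj_rankOne, sum_apply, sum_inner, Complex.re_sum, re_inner_rankOne_self]
  have hx : (inner ℂ x x : ℂ).re = ‖x‖ ^ 2 := inner_self_eq_norm_sq (𝕜 := ℂ) x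
  have hlow : Tendsto (fun N => ‖x‖ ^ 2 - ∑ i, (inner ℂ ((Phi (T i) ^ N) 1 x) x).re) atTop
      (𝓝 (‖x‖ ^ 2 - ∑ _i : Fin k, 0)) := by
    refine tendsto_const_nhds.sub (tendsto_finsetSum _ fun i _ => ?_)
    have := (hpure i x).inner (𝕜 := ℂ) (tendsto_const_nhds (x := x))
    rw [inner_zero_left] at this
    exact (Complex.continuous_re.tendsto 0).comp this
  rw [Finset.sum_const_zero, sub_zero] at hlow
  -- The partial sums are squeezed between the bound from `one_sub_le_sum_conj`, which tends to
  -- `‖x‖²` by purity, and `‖x‖²` itself.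
  refine tendsto_of_tendsto_of_tendsto_of_le_of_le hlow tendsto_const_nhds (fun N => ?_)
    (fun N => ?_)
  · have h := ((ContinuousLinearMap.le_def _ _).1 (hT.one_sub_le_sum_conj N)).re_inner_nonneg_left x
    rw [sub_apply, inner_sub_left, map_sub, sub_nonneg] at h
    simp only [RCLike.re_to_complex] at h
    rw [hre] at h
    simpa only [sub_apply, one_apply_eq_self, sum_apply, inner_sub_left, sum_inner, Complex.sub_re,
      Complex.re_sum, hx] using h
  · have h := ((ContinuousLinearMap.le_def _ _).1
      (hT.sum_conj_le (multiWordsLT n N))).re_inner_nonneg_left x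
    rw [sub_apply, inner_sub_left, map_sub, sub_nonneg] at h
    simp only [RCLike.re_to_complex] at h
    rw [hre, one_apply_eq_self, hx] at h
    exact h

/-! ### Defect operators of rank one -/

/-- A positive operator of rank one is of the form `v ⊗ v^*`. -/
theorem exists_eq_rankOne_self {A : H →L[ℂ] H} (hA : 0 ≤ A)
    (hr : Module.finrank ℂ (LinearMap.range (A : H →ₗ[ℂ] H)) = 1) :
    ∃ v : H, v ≠ 0 ∧ A = rankOne ℂ v v := by
  obtain ⟨⟨u, hu⟩, hu0, hspan⟩ := finrank_eq_one_iff'.1 hr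
  have hu0' : u ≠ 0 := fun h => hu0 (Subtype.ext h)
  have hN : (0 : ℝ) < ‖u‖ ^ 2 := by positivity
  have hNC : ((‖u‖ : ℂ)) ^ 2 ≠ 0 := by exact_mod_cast hN.ne'
  have hex : ∀ x, ∃ c : ℂ, A x = c • u := fun x => by
    obtain ⟨c, hc⟩ := hspan ⟨A x, x, rfl⟩
    exact ⟨c, (congrArg Subtype.val hc).symm⟩
  have hpos : A.IsPositive := (ContinuousLinearMap.nonneg_iff_isPositive A).1 hA
  obtain ⟨t, ht⟩ := hex u
  have h1 : inner ℂ (A u) u = (starRingEnd ℂ t) * (‖u‖ : ℂ) ^ 2 := by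
    rw [ht, inner_smul_left, inner_self_eq_norm_sq_to_K]
    rfl
  -- Symmetry `⟨A u, x⟩ = ⟨u, A x⟩` determines the coefficient of `A x` along `u`.
  have h2 : ∀ x, A x = ((starRingEnd ℂ t) / (‖u‖ : ℂ) ^ 2 * inner ℂ u x) • u := by
    intro x
    obtain ⟨c, hc⟩ := hex x
    have h3 : inner ℂ (A u) x = inner ℂ u (A x) := hpos.isSymmetric u x
    rw [ht, hc, inner_smul_left, inner_smul_right, inner_self_eq_norm_sq_to_K] at h3
    have h4 : c = (starRingEnd ℂ t) / (‖u‖ : ℂ) ^ 2 * inner ℂ u x := by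
      rw [div_mul_eq_mul_div, eq_div_iff hNC]
      exact h3.symm
    rw [hc, ← h4]
  -- The scalar equals `⟨A u, u⟩ / ‖u‖⁴`, real and nonnegative because `A` is positive; its square
  -- root rescales `u` to `v`.
  obtain ⟨r, hr0, hrt⟩ : ∃ r : ℝ, 0 ≤ r ∧ (starRingEnd ℂ t) / (‖u‖ : ℂ) ^ 2 = (r : ℂ) := by
    have h5 : (inner ℂ (A u) u : ℂ) = ((inner ℂ (A u) u : ℂ).re : ℂ) := by
      have := (hpos.isSymmetric).coe_reApplyInnerSelf_apply u
      exact this.symm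
    refine ⟨(inner ℂ (A u) u : ℂ).re / (‖u‖ ^ 2) ^ 2,
      div_nonneg (hpos.re_inner_nonneg_left u) (by positivity), ?_⟩
    push_cast
    rw [← h5, h1]
    field_simp
  have hA2 : A = rankOne ℂ ((Real.sqrt r : ℂ) • u) ((Real.sqrt r : ℂ) • u) := by
    ext x
    rw [h2, hrt, InnerProductSpace.rankOne_apply, inner_smul_left, smul_smul, Complex.conj_ofReal,
      mul_right_comm, ← Complex.ofReal_mul, Real.mul_self_sqrt hr0]
  refine ⟨_, fun h0 => ?_, hA2⟩
  rw [h0] at hA2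
  simp only [map_zero] at hA2
  obtain ⟨w, rfl⟩ := hu
  exact hu0' (by rw [hA2]; rfl)

theorem defectRange_eq_span {T : OpTuple n H} {v : H} (hv : defect T = rankOne ℂ v v)
    (hv0 : v ≠ 0) : defectRange T = Submodule.span ℂ {v} := by
  refine le_antisymm ?_ ?_
  · rintro _ ⟨x, rfl⟩
    rw [ContinuousLinearMap.coe_coe, hv]
    exact Submodule.smul_mem _ _ (Submodule.mem_span_singleton_self v)
  · rw [Submodule.span_singleton_le_iff_mem]
    refine ⟨(inner ℂ v v : ℂ)⁻¹ • v, ?_⟩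
    rw [ContinuousLinearMap.coe_coe, hv, map_smul, InnerProductSpace.rankOne_apply, smul_smul,
      inv_mul_cancel₀ (inner_self_ne_zero.2 hv0), one_smul]

/-! ### Consequences of the grading -/

theorem wordOp_intertwine {m : ℕ} (X : Fin m → (H →L[ℂ] H)) (u : H →L[ℂ] H) (z : ℂ)
    (h : ∀ j, u * X j = z • (X j * u)) (w : FreeMonoid (Fin m)) :
    u * wordOp X w = z ^ w.length • (wordOp X w * u) := by
  induction w using FreeMonoid.inductionOn' with
  | one => simp
  | of_mul j w ih =>
    have hj : wordOp X (FreeMonoid.of j) = X j := FreeMonoid.lift_eval_of _ _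
    rw [map_mul, hj, ← mul_assoc, h, smul_mul_assoc, mul_assoc, ih, mul_smul_comm, smul_smul,
      FreeMonoid.length_mul, FreeMonoid.length_of, pow_add, pow_one, mul_assoc]

theorem multiWordOp_intertwine (T : OpTuple n H) (u : H →L[ℂ] H) (z : Fin k → ℂ)
    (h : ∀ i j, u * T i j = z i • (T i j * u)) (α : MultiWord n) :
    u * multiWordOp T α = (∏ i, z i ^ multiDegree α i) • (multiWordOp T α * u) :=
  prod_ofFn_intertwine u _ _ fun i => wordOp_intertwine (T i) u (z i) (h i) (α i)

/-- Conjugation by `u` commutes with each `Φ_{T_i}`, since the phase `z i` meets its conjugate. It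
also fixes the identity operator, hence it fixes `Δ`. -/
theorem commute_defect (T : OpTuple n H) {u : H →L[ℂ] H} (hu : u ∈ unitary (H →L[ℂ] H))
    (z : Fin k → Circle) (h : ∀ i j, u * T i j = (z i : ℂ) • (T i j * u)) :
    u * defect T = defect T * u := by
  have hphi : ∀ i, Commute (conj u) (Phi (T i)) := by
    intro i
    rw [phi_eq]
    refine Commute.sum_right _ _ _ fun j _ => ?_
    rw [commute_iff_eq, ← map_mul, ← map_mul, h]
    ext1 Y
    simp only [conj_apply, star_smul, smul_mul_assoc, mul_smul_comm, smul_smul]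
    have hz : star (z i : ℂ) * (z i : ℂ) = 1 := by
      rw [Complex.star_def, ← Complex.normSq_eq_conj_mul_self, Circle.normSq_coe, Complex.ofReal_one]
    rw [hz, one_smul]
  have hcomm : Commute (conj u) (defectMap T fun _ => 1) := by
    refine Commute.list_prod_right _ _ fun x hx => ?_
    obtain ⟨i, rfl⟩ := (List.mem_ofFn' _ _).1 hx
    exact (Commute.sub_right (Commute.one_right _) (hphi i)).pow_right _
  have h1 : conj u (defect T) = defect T := by
    have := congrArg (fun f : Module.End ℂ (H →L[ℂ] H) => f 1) hcomm.eq
    simp only [Module.End.mul_apply] at this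
    rw [conj_apply u 1, mul_one, Unitary.mul_star_self_of_mem hu] at this
    exact this
  rw [conj_apply] at h1
  conv_rhs => rw [← h1, mul_assoc, Unitary.star_mul_self_of_mem hu, mul_one]

theorem exists_circle_pow_ne {a b : ℕ} (h : a ≠ b) :
    ∃ z : Circle, (z : ℂ) ^ a ≠ (z : ℂ) ^ b := by
  -- With this angle both multiples `a θ` and `b θ` lie in `[0, 1]`, inside the interval `(-π, π]`
  -- on which `arg` recovers the angle.
  refine ⟨Circle.exp (1 / (a + b + 1)), fun hz => h ?_⟩
  have hz' : Circle.exp (1 / (a + b + 1)) ^ a = Circle.exp (1 / (a + b + 1)) ^ b := by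
    ext
    simpa using hz
  rw [← Circle.exp_nsmul, ← Circle.exp_nsmul] at hz'
  have hbound : ∀ c : ℕ, c ≤ a + b → -Real.pi < c • ((1 : ℝ) / (a + b + 1)) ∧
      c • ((1 : ℝ) / (a + b + 1)) ≤ Real.pi := by
    intro c hc
    have h0 : 0 ≤ c • ((1 : ℝ) / (a + b + 1)) := by positivity
    have h1 : c • ((1 : ℝ) / (a + b + 1)) ≤ 1 := by
      rw [nsmul_eq_mul, mul_one_div, div_le_one (by positivity)]
      exact_mod_cast hc.trans (Nat.le_succ _)
    exact ⟨(neg_lt_zero.2 Real.pi_pos).trans_le h0, h1.trans (by linarith [Real.pi_gt_three])⟩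
  have ha := hbound a (Nat.le_add_right _ _)
  have hb := hbound b (Nat.le_add_left _ _)
  have := congrArg (fun w : Circle => (w : ℂ).arg) hz'
  rw [Circle.arg_exp ha.1 ha.2, Circle.arg_exp hb.1 hb.2, nsmul_eq_mul, nsmul_eq_mul] at this
  exact_mod_cast mul_right_cancel₀ (by positivity) this

/-- In a graded tuple of rank one, vectors `T_α v`, `T_β v` of different multi-degrees are
orthogonal. -/
theorem IsGraded.inner_multiWordOp_eq_zero {T : OpTuple n H} (hT : IsGraded T) {v : H}
    (hv : defect T = rankOne ℂ v v) (hv0 : v ≠ 0) {α β : MultiWord n}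
    (h : multiDegree α ≠ multiDegree β) :
    inner ℂ (multiWordOp T α v) (multiWordOp T β v) = 0 := by
  classical
  obtain ⟨U, -, hU⟩ := hT
  obtain ⟨i, hi⟩ := Function.ne_iff.1 h
  obtain ⟨ζ, hζ⟩ := exists_circle_pow_ne hi
  -- Only a coordinate `i` in which the degrees differ is rotated, so the gauge unitary sees just
  -- the `i`-th degree.
  set z : Fin k → Circle := Function.update 1 i ζ with hz
  have hprod : ∀ γ : MultiWord n, ∏ l, (z l : ℂ) ^ multiDegree γ l = (ζ : ℂ) ^ multiDegree γ i := by
    intro γ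
    rw [Fintype.prod_eq_single i]
    · simp [hz]
    · intro l hl
      simp [hz, hl]
  set u : H →L[ℂ] H := (U z : H →L[ℂ] H) with hu
  have humem : u ∈ unitary (H →L[ℂ] H) := (U z).2
  have hint : ∀ i j, u * T i j = (z i : ℂ) • (T i j * u) := by
    intro i j
    rw [← smul_mul_assoc, ← hU z i j, mul_assoc, Unitary.star_mul_self_of_mem humem, mul_one]
  have hinner : ∀ x y, inner ℂ (u x) (u y) = inner ℂ x y := by
    intro x y
    rw [← ContinuousLinearMap.adjoint_inner_right, ← ContinuousLinearMap.star_eq_adjoint,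
      ← mul_apply_eq_comp, Unitary.star_mul_self_of_mem humem, one_apply_eq_self]
  -- The unitary commutes with `v ⊗ v^*`, so it preserves the line through `v`. Hence every `T_γ v`
  -- is an eigenvector with eigenvalue `ζ ^ |γ_i| * χ`, and unitarity forces eigenvectors with
  -- distinct eigenvalues to be orthogonal.
  obtain ⟨χ, hχ⟩ : ∃ χ : ℂ, u v = χ • v := by
    have h1 := congrArg (fun A : H →L[ℂ] H => A v) (commute_defect T humem z hint)
    simp only [mul_apply_eq_comp, hv, InnerProductSpace.rankOne_apply, map_smul] at h1
    refine ⟨(inner ℂ v v)⁻¹ * inner ℂ v (u v), ?_⟩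
    rw [mul_smul, ← h1, smul_smul, inv_mul_cancel₀ (inner_self_ne_zero.2 hv0), one_smul]
  have hχ1 : starRingEnd ℂ χ * χ = 1 := by
    have h1 := hinner v v
    rw [hχ, inner_smul_left, inner_smul_right, ← mul_assoc] at h1
    exact mul_right_cancel₀ (inner_self_ne_zero.2 hv0) (h1.trans (one_mul _).symm)
  have happ : ∀ γ, u (multiWordOp T γ v) = ((ζ : ℂ) ^ multiDegree γ i * χ) • multiWordOp T γ v := by
    intro γ
    have h1 := congrArg (fun A : H →L[ℂ] H => A v) (multiWordOp_intertwine T u _ hint γ)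
    simp only [mul_apply_eq_comp, smul_apply, hχ, map_smul, smul_smul, hprod] at h1
    exact h1
  have h2 := hinner (multiWordOp T α v) (multiWordOp T β v)
  rw [happ, happ, inner_smul_left, inner_smul_right, ← mul_assoc, map_mul] at h2
  by_contra hne
  have h3 : starRingEnd ℂ ((ζ : ℂ) ^ multiDegree α i) * (ζ : ℂ) ^ multiDegree β i = 1 := by
    have h4 := mul_right_cancel₀ hne (h2.trans (one_mul _).symm)
    calc _ = starRingEnd ℂ ((ζ : ℂ) ^ multiDegree α i) * (ζ : ℂ) ^ multiDegree β i *
        (starRingEnd ℂ χ * χ) := by rw [hχ1, mul_one]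
      _ = _ := by rw [← h4]; ring
  have h5 : (ζ : ℂ) ^ multiDegree α i * starRingEnd ℂ ((ζ : ℂ) ^ multiDegree α i) = 1 := by
    rw [Complex.mul_conj, map_pow, Circle.normSq_coe, one_pow, Complex.ofReal_one]
  refine hζ ?_
  calc (ζ : ℂ) ^ multiDegree α i = (ζ : ℂ) ^ multiDegree α i *
        (starRingEnd ℂ ((ζ : ℂ) ^ multiDegree α i) * (ζ : ℂ) ^ multiDegree β i) := by
          rw [h3, mul_one]
    _ = _ := by rw [← mul_assoc, h5, one_mul]

/-! ### The Euler spaces -/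

theorem eulerSpace_eq_span {T : OpTuple n H} {v : H} (hv : defect T = rankOne ℂ v v)
    (hv0 : v ≠ 0) (q : Fin k → ℕ) :
    eulerSpace T q = Submodule.span ℂ ((fun β => multiWordOp T β v) '' wordsUpTo n q) := by
  refine le_antisymm (Submodule.span_le.2 ?_) (Submodule.span_le.2 ?_)
  · rintro _ ⟨α, h, hα, hh, rfl⟩
    rw [defectRange_eq_span hv hv0, Submodule.mem_span_singleton] at hh
    obtain ⟨c, rfl⟩ := hh
    rw [map_smul]
    exact Submodule.smul_mem _ _ (Submodule.subset_span ⟨α, mem_wordsUpTo.2 hα, rfl⟩)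
  · rintro _ ⟨α, hα, rfl⟩
    refine Submodule.subset_span ⟨α, v, mem_wordsUpTo.1 hα, ?_, rfl⟩
    rw [defectRange_eq_span hv hv0]
    exact Submodule.mem_span_singleton_self v

/-- The trace of `∑_{|β| = q} T_β Δ T_β^*`. -/
def degreeWeight (T : OpTuple n H) (v : H) (q : Fin k → ℕ) : ℝ :=
  ∑ β ∈ wordsOfDegree n q, ‖multiWordOp T β v‖ ^ 2

/-- A vector spanned by degrees at most `q` is orthogonal to all other `T_β v`, so its Parseval sums
over `H` are constant once they contain all words of degree at most `q`. The finite family is thus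
Parseval on its own span. -/
theorem InPolyball.sum_inner_sq_of_mem {T : OpTuple n H} (hT : InPolyball T) (hpure : IsPure T)
    (hgraded : IsGraded T) {v : H} (hv : defect T = rankOne ℂ v v) (hv0 : v ≠ 0)
    (q : Fin k → ℕ) {x : H}
    (hx : x ∈ Submodule.span ℂ ((fun β => multiWordOp T β v) '' wordsUpTo n q)) :
    ∑ β ∈ wordsUpTo n q, ‖inner ℂ (multiWordOp T β v) x‖ ^ 2 = ‖x‖ ^ 2 := by
  refine tendsto_nhds_unique (tendsto_const_nhds.congr' ?_)
    (hT.tendsto_sum_inner_sq hpure hv x)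
  -- Any `N` above `∑ q i` exceeds every `q i`, so all words of degree at most `q` are included.
  filter_upwards [eventually_gt_atTop (∑ i, q i)] with N hN
  refine Finset.sum_subset (fun β hβ => ?_) fun β _ hβ => ?_
  · rw [multiWordsLT, Fintype.mem_piFinset]
    intro i
    refine mem_wordsLT _ _ (lt_of_le_of_lt ?_ hN)
    exact (mem_wordsUpTo.1 hβ i).trans
      (Finset.single_le_sum (f := q) (fun _ _ => Nat.zero_le _) (Finset.mem_univ i))
  · have h0 : inner ℂ (multiWordOp T β v) x = 0 := by
      induction hx using Submodule.span_induction with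
      | mem y hy =>
        obtain ⟨α, hα, rfl⟩ := hy
        refine hgraded.inner_multiWordOp_eq_zero hv hv0 fun h => hβ ?_
        rw [mem_wordsUpTo, h]
        exact mem_wordsUpTo.1 hα
      | zero => exact inner_zero_right _
      | add y z _ _ hy hz => rw [inner_add_right, hy, hz, add_zero]
      | smul c y _ hy => rw [inner_smul_right, hy, mul_zero]
    rw [h0, norm_zero, sq, zero_mul]

theorem InPolyball.finrank_eulerSpace {T : OpTuple n H} (hT : InPolyball T) (hpure : IsPure T)
    (hgraded : IsGraded T) {v : H} (hv : defect T = rankOne ℂ v v) (hv0 : v ≠ 0)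
    (q : Fin k → ℕ) :
    (Module.finrank ℂ (eulerSpace T q) : ℝ) = ∑ s ∈ boxIndex q, degreeWeight T v s := by
  rw [eulerSpace_eq_span hv hv0, finrank_span_eq_sum_norm_sq _ _
    fun x hx => hT.sum_inner_sq_of_mem hpure hgraded hv hv0 q hx]
  exact sum_wordsUpTo q _

/-! ### The curvature terms -/

open Classical in
-- There are finitely many words of degree `q`, so the candidate is a finite sum lying in the span;
-- the remainder has zero coordinates at these words and is orthogonal to the generators.
theorem degreeProj_apply {E : Type*} [NormedAddCommGroup E] [InnerProductSpace ℂ E]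
    [CompleteSpace E] (q : Fin k → ℕ) (f : Fock n E) :
    degreeProj n E q f = ∑ β ∈ wordsOfDegree n q, lp.single 2 β (f β) := by
  refine Submodule.eq_starProjection_of_mem_orthogonal ?_ ?_
  · refine Submodule.sum_mem _ fun β hβ => Submodule.le_topologicalClosure _
      (Submodule.subset_span ⟨β, f β, fun i => ?_, rfl⟩)
    exact congrFun (mem_wordsOfDegree.1 hβ) i
  · rw [degreeSubspace, Submodule.orthogonal_closure, Submodule.mem_orthogonal]
    intro g hg
    induction hg using Submodule.span_induction with
    | mem g hg =>
      obtain ⟨β, x, hβ, rfl⟩ := hg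
      have hβ' : β ∈ wordsOfDegree n q := mem_wordsOfDegree.2 (funext hβ)
      rw [inner_sub_right, inner_sum, lp.inner_single_left, Finset.sum_eq_single_of_mem β hβ',
        lp.inner_single_left, lp.single_apply_self, sub_self]
      intro γ _ hγ
      rw [lp.inner_single_left, lp.single_apply_ne _ _ _ hγ.symm, inner_zero_right]
    | zero => exact inner_zero_left _
    | add y z _ _ hy hz => rw [inner_add_left, hy, hz, add_zero]
    | smul c y _ hy => rw [inner_smul_left, hy, mul_zero]

theorem opTrace_degreeProj (q : Fin k → ℕ) :
    (opTrace (degreeProj n ℂ q)).toReal = ∏ i, (n i : ℝ) ^ q i := by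
  classical
  have h : degreeProj n ℂ q = ∑ β ∈ wordsOfDegree n q,
      rankOne ℂ (lp.single 2 β (1 : ℂ) : Fock n ℂ) (lp.single 2 β (1 : ℂ)) := by
    ext1 f
    rw [degreeProj_apply, sum_apply]
    refine Finset.sum_congr rfl fun β _ => ?_
    rw [InnerProductSpace.rankOne_apply, lp.inner_single_left, ← lp.single_smul]
    simp
  rw [h, opTrace_sum_rankOne, ENNReal.toReal_ofReal (by positivity)]
  simp only [lp.norm_single (p := 2) (by norm_num), norm_one, one_pow, Finset.sum_const,
    card_wordsOfDegree, nsmul_eq_mul, mul_one]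
  push_cast
  rfl

theorem InPolyball.inner_berezinCoord {T : OpTuple n H} (hT : InPolyball T) (β : MultiWord n)
    (x y : H) : inner ℂ (berezinCoord T hT β x) (berezinCoord T hT β y)
      = inner ℂ (conj (multiWordOp T β) (defect T) x) y := by
  have hdef : 0 ≤ defect T := hT.nonneg _ fun _ => le_rfl
  have hsa : star (CFC.sqrt (defect T)) = CFC.sqrt (defect T) :=
    (CFC.sqrt_nonneg (defect T)).isSelfAdjoint
  change inner ℂ (CFC.sqrt (defect T) (multiWordOpStar T β x))
    (CFC.sqrt (defect T) (multiWordOpStar T β y)) = _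
  rw [← ContinuousLinearMap.adjoint_inner_left, ← ContinuousLinearMap.star_eq_adjoint, hsa,
    ← mul_apply_eq_comp, CFC.sqrt_mul_sqrt_self (defect T) hdef, hT.multiWordOpStar_eq,
    conj_apply, mul_apply_eq_comp, mul_apply_eq_comp, ContinuousLinearMap.star_eq_adjoint,
    ContinuousLinearMap.adjoint_inner_right]

/-- The projection selects the coordinates of degree `q`, and in each of them the two square roots
of `Δ` recombine to `T_β Δ T_β^*`. -/
theorem InPolyball.berezin_degreeProj {T : OpTuple n H} (hT : InPolyball T) (q : Fin k → ℕ) :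
    ContinuousLinearMap.adjoint (berezinKernel T hT) ∘L
      degreeProj n (DefectSpace T) q ∘L berezinKernel T hT
      = ∑ β ∈ wordsOfDegree n q, conj (multiWordOp T β) (defect T) := by
  classical
  ext1 x
  refine ext_inner_right ℂ fun y => ?_
  rw [ContinuousLinearMap.comp_apply, ContinuousLinearMap.comp_apply,
    ContinuousLinearMap.adjoint_inner_left, degreeProj_apply, sum_inner, sum_apply, sum_inner]
  refine Finset.sum_congr rfl fun β _ => ?_
  rw [lp.inner_single_left]
  exact hT.inner_berezinCoord β x y

theorem InPolyball.curvTerm_eq {T : OpTuple n H} (hT : InPolyball T) {v : H}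
    (hv : defect T = rankOne ℂ v v) (q : Fin k → ℕ) :
    curvTerm T hT q = degreeWeight T v q / ∏ i, (n i : ℝ) ^ q i := by
  rw [curvTerm, opTrace_degreeProj, hT.berezin_degreeProj, hv]
  simp only [conj_rankOne]
  rw [opTrace_sum_rankOne, ENNReal.toReal_ofReal (by positivity), degreeWeight]

/-! ### Monotonicity and the main theorem -/

theorem degreeWeight_nonneg (T : OpTuple n H) (v : H) (q : Fin k → ℕ) : 0 ≤ degreeWeight T v q :=
  Finset.sum_nonneg fun _ _ => by positivity

/-- Raising the `i`-th degree by one prefixes the `i`-th word with one of `n i` letters. By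
cross-commutation the letter acts in front of the whole product, where it is a contraction. -/
theorem InPolyball.degreeWeight_add_single_le {T : OpTuple n H} (hT : InPolyball T) (v : H)
    (q : Fin k → ℕ) (i : Fin k) :
    degreeWeight T v (q + Pi.single i 1) ≤ n i * degreeWeight T v q := by
  classical
  -- Covering the words of degree `q + e_i` by the image of `φ` suffices: all terms are nonnegative,
  -- so overcounting only weakens the bound.
  let φ : Fin (n i) × MultiWord n → MultiWord n := fun x =>
    Function.update x.2 i (FreeMonoid.of x.1 * x.2 i)
  have hsub : wordsOfDegree n (q + Pi.single i 1)
      ⊆ (Finset.univ ×ˢ wordsOfDegree n q).image φ := by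
    intro β hβ
    rw [mem_wordsOfDegree] at hβ
    have hlen : (β i).length = q i + 1 := by
      have := congrFun hβ i
      simpa [multiDegree] using this
    obtain ⟨j, w, hw⟩ : ∃ j w, β i = FreeMonoid.of j * w := by
      generalize β i = b at hlen
      induction b using FreeMonoid.casesOn with
      | one => simp at hlen
      | of_mul j w => exact ⟨j, w, rfl⟩
    rw [Finset.mem_image]
    refine ⟨(j, Function.update β i w), ?_, ?_⟩
    · rw [Finset.mem_product, mem_wordsOfDegree]
      refine ⟨Finset.mem_univ _, funext fun l => ?_⟩
      by_cases hl : l = i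
      · subst hl
        rw [hw, FreeMonoid.length_mul, FreeMonoid.length_of] at hlen
        simp only [multiDegree, Function.update_self]
        omega
      · have := congrFun hβ l
        simpa [multiDegree, hl] using this
    · simp [φ, ← hw]
  calc degreeWeight T v (q + Pi.single i 1)
      ≤ ∑ β ∈ (Finset.univ ×ˢ wordsOfDegree n q).image φ, ‖multiWordOp T β v‖ ^ 2 :=
        Finset.sum_le_sum_of_subset_of_nonneg hsub fun _ _ _ => by positivity
    _ ≤ ∑ x ∈ Finset.univ ×ˢ wordsOfDegree n q, ‖multiWordOp T (φ x) v‖ ^ 2 :=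
        Finset.sum_image_le_of_nonneg fun _ _ => by positivity
    _ ≤ ∑ x ∈ (Finset.univ : Finset (Fin (n i))) ×ˢ wordsOfDegree n q,
          ‖multiWordOp T x.2 v‖ ^ 2 := by
        refine Finset.sum_le_sum fun x _ => ?_
        rw [← hT.mul_multiWordOp, mul_apply_eq_comp]
        gcongr
        exact hT.norm_apply_le _ _ _
    _ = n i * degreeWeight T v q := by
        rw [Finset.sum_product]
        simp [degreeWeight]

theorem InPolyball.antitone_degreeWeight_div {T : OpTuple n H} (hT : InPolyball T)
    (hn : ∀ i, 0 < n i) (v : H) :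
    Antitone fun q => degreeWeight T v q / ∏ i, (n i : ℝ) ^ q i := by
  refine antitone_of_add_single_le fun q i => ?_
  have hn' : ∀ i, (0 : ℝ) < n i := fun i => Nat.cast_pos.2 (hn i)
  have hprod : ∏ l, (n l : ℝ) ^ (q + Pi.single i 1 : Fin k → ℕ) l = n i * ∏ l, (n l : ℝ) ^ q l := by
    simp only [Pi.add_apply, pow_add, Finset.prod_mul_distrib]
    rw [mul_comm, Fintype.prod_eq_single i]
    · simp
    · intro l hl
      simp [hl]
  simp only [hprod]
  refine (div_le_div_of_nonneg_right (hT.degreeWeight_add_single_le v q i) ?_).trans_eq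
    (mul_div_mul_left _ _ (hn' i).ne')
  exact mul_nonneg (hn' i).le (Finset.prod_nonneg fun l _ => pow_nonneg (hn' l).le _)

end NCPolyball

end

open NCPolyball in
theorem theorem3p2 {H : Type*} [NormedAddCommGroup H] [InnerProductSpace ℂ H] [CompleteSpace H]
    {k : ℕ} (n : Fin k → ℕ) (hn : ∀ i, 2 ≤ n i)
    (T : NCPolyball.OpTuple n H) (hT : NCPolyball.InPolyball T)
    (hpure : NCPolyball.IsPure T) (hrank : NCPolyball.HasRankOne T)
    (hgraded : NCPolyball.IsGraded T) :
    ∃ c : ℝ, NCPolyball.HasCurvature T hT c ∧ NCPolyball.HasEulerChar T c := by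
  obtain ⟨v, hv0, hv⟩ := exists_eq_rankOne_self (hT.nonneg _ fun _ => le_rfl) hrank
  change defect T = _ at hv
  have hn0 : ∀ i, 0 < n i := fun i => zero_lt_two.trans_le (hn i)
  set a : (Fin k → ℕ) → ℝ := fun q => degreeWeight T v q / ∏ i, (n i : ℝ) ^ q i with ha
  have hanti : Antitone a := hT.antitone_degreeWeight_div hn0 v
  have ha0 : ∀ q, 0 ≤ a q := fun q =>
    div_nonneg (degreeWeight_nonneg T v q) (by positivity)
  have hlim := tendsto_atTop_ciInf hanti ⟨0, Set.forall_mem_range.2 ha0⟩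
  set c := ⨅ q, a q
  -- Both `a s` and `c` lie in `[0, a 0]`; this supplies the uniform bound that the averaging lemmas
  -- require.
  have hM : ∀ s, |a s - c| ≤ a 0 := by
    intro s
    have h1 : c ≤ a s := hanti.le_of_tendsto hlim s
    have h2 : 0 ≤ c := ge_of_tendsto' hlim ha0
    have h3 : a s ≤ a 0 := hanti zero_le
    rw [abs_of_nonneg (sub_nonneg.2 h1)]
    linarith
  refine ⟨c, ⟨?_, ?_⟩, ?_, ?_⟩
  · have := opTrace_sum_rankOne {()} fun _ => v
    rw [Finset.sum_singleton, ← hv] at this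
    rw [this]
    exact ENNReal.ofReal_lt_top
  · simp only [hT.curvTerm_eq hv]
    exact tendsto_simplex_average hM hlim
  · exact Module.finite_of_finrank_pos (hrank.symm ▸ zero_lt_one)
  · intro q hq hcof
    have hqlim : Tendsto q atTop atTop := tendsto_atTop_atTop_of_monotone hq hcof
    -- With weights `∏ n_i^{s_i}` the normalisation of `a s` cancels, so the weighted sum is `∑_{s ≤
    -- q} w(s) = dim M_q` and the total weight is the denominator of the Euler quotient.
    refine (tendsto_box_average hM hlim (b := fun i => (n i : ℝ))
      (fun i => by exact_mod_cast hn0 i) hqlim).congr fun m => ?_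
    rw [eulerTerm, hT.finrank_eulerSpace hpure hgraded hv hv0]
    congr 1
    refine Finset.sum_congr rfl fun s _ => ?_
    have : ∏ i, (n i : ℝ) ^ s i ≠ 0 :=
      Finset.prod_ne_zero_iff.2 fun i _ => pow_ne_zero _ (Nat.cast_ne_zero.2 (hn0 i).ne')
    rw [ha, mul_div_cancel₀ _ this]
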